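/- Let $\alpha,\beta>-1$ and let $m\ge 0$ be an integer. On $[-1,1]^2$ consider the weight function $$\mathcal W_{\alpha,\beta,-\frac12}(x,y)=|x-y|^{2\alpha+1}\,|x+y|^{2\beta+1}\,(1-x^2)^{-1/2}(1-y^2)^{-1/2}$$ (up to a positive constant factor). Let $p_n^{(\alpha,\beta)}$ be the orthonormal Jacobi polynomials, with positive leading coefficients, for the weight $(1-t)^\alpha(1+t)^\beta$ on $[-1,1]$ normalized to have integral $1$. For $0\le k\le n$ let $P_{k,n}^{\alpha,\beta}(u,v)$ be the polynomial determined by $$P_{k,n}^{\alpha,\beta}(x+y,xy)=p_n^{(\alpha,\beta)}(x)p_k^{(\alpha,\beta)}(y)+p_n^{(\alpha,\beta)}(y)p_k^{(\alpha,\beta)}(x)\quad(k<n),\qquad P_{n,n}^{\alpha,\beta}(x+y,xy)=\sqrt2\,p_n^{(\alpha,\beta)}(x)p_n^{(\alpha,\beta)}(y).$$ Define $${}_1Q_{k,2n}(x,y)=P_{k,n}^{\alpha,\beta}(2xy,x^2+y^2-1),\qquad 0\le k\le n,$$ $${}_2Q_{k,2n}(x,y)=\tfrac{(\alpha+\beta+2)(\alpha+\beta+3)}{4(\alpha+1)(\beta+1)}\,(x^2-y^2)\,P_{k,n-1}^{\alpha+1,\beta+1}(2xy,x^2+y^2-1),\qquad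 0\le k\le n-1,$$ $${}_2Q_{k,2n+1}(x,y)=\tfrac{\alpha+\beta+2}{2(\alpha+1)}\,(x-y)\,P_{k,n}^{\alpha+1,\beta}(2xy,x^2+y^2-1),\qquad 0\le k\le n,$$ and let $\mathbb Q_{2n}$ be the column vector of the $2n+1$ polynomials ${}_1Q_{k,2n}$, $0\le k\le n$, and ${}_2Q_{k,2n}$, $0\le k\le n-1$. Let $\theta_0=0$ and let $0<\theta_1<\dots<\theta_m<\pi$ be such that $\cos\theta_1,\dots,\cos\theta_m$ are the zeros of $p_m^{(\alpha+1,\beta)}$. Let $X_m$ be the set of the points $$(s_{j,k},t_{j,k}),\ (t_{j,k},s_{j,k}),\ (-s_{j,k},-t_{j,k}),\ (-t_{j,k},-s_{j,k}),\quad s_{j,k}=\cos\tfrac{\theta_j-\theta_k}2,\ t_{j,k}=\cos\tfrac{\theta_j+\theta_k}2,\quad 0\le j\le k\le m,$$ the nodes of the near-minimal cubature rule of degree $4m+1$ for $\mathcal W_{\alpha,\beta,-\frac12}$. Put $n=2m+1$. A polynomial $P$ is called $(2n-1)$-orthogonal if $\int_{[-1,1]^2}PQ\,\mathcal W_{\alpha,\beta,-\frac12}\,dx\,dy=0$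 for all polynomials $Q$ with $\deg P+\deg Q\le 2n-1$. **Theorem.** The polynomials ${}_2Q_{k,2m+1}$, $0\le k\le m$, are orthogonal polynomials of degree $n=2m+1$ with respect to $\mathcal W_{\alpha,\beta,-\frac12}$ (they have degree at most $2m+1$ and are orthogonal to all polynomials of degree at most $2m$), and there is a real matrix $\Gamma$ of size $(2m+3)\times(2m+1)$ such that all entries of $\mathbb Q_{2m+2}+\Gamma\,\mathbb Q_{2m}$ are $(2n-1)$-orthogonal polynomials and $X_m$ is the variety of the ideal of $\mathbb R[x,y]$ generated by ${}_2Q_{k,2m+1}$, $0\le k\le m$, together with the entries of $\mathbb Q_{2m+2}+\Gamma\,\mathbb Q_{2m}$. This holds both for the variety in $\mathbb R^2$ and for the variety in $\mathbb C^2$ (all common zeros are real). -/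

import Mathlib

open MeasureTheory Polynomial

noncomputable section

/-- The Jacobi weight `(1 - t)^α (1 + t)^β` on `[-1, 1]`. -/
def jacobiWeight (α β t : ℝ) : ℝ := (1 - t) ^ α * (1 + t) ^ β

/-- The inner product `∫ p q w* dt` on `[-1, 1]`, where `w*` is the Jacobi weight divided by its
total mass. -/
def jacobiInner (α β : ℝ) (p q : ℝ[X]) : ℝ :=
  (∫ t in (-1 : ℝ)..1, p.eval t * q.eval t * jacobiWeight α β t) /
    ∫ t in (-1 : ℝ)..1, jacobiWeight α β t

/-- The monic Jacobi polynomial of degree `n`: the monomials, orthogonalized with respect to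
`jacobiInner α β` by the Gram-Schmidt process. -/
def jacobiMonic (α β : ℝ) (n : ℕ) : ℝ[X] :=
  X ^ n - ∑ i : Fin n,
    C (jacobiInner α β (X ^ n) (jacobiMonic α β i) /
      jacobiInner α β (jacobiMonic α β i) (jacobiMonic α β i)) * jacobiMonic α β i
termination_by n
decreasing_by all_goals exact i.2

/-- The orthonormal Jacobi polynomial `p_n^{(α,β)}` (with positive leading coefficient). -/
def jacobiP (α β : ℝ) (n : ℕ) : ℝ[X] :=
  C (√(jacobiInner α β (jacobiMonic α β n) (jacobiMonic α β n)))⁻¹ * jacobiMonic α β n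

/-- The symmetric polynomial `p_n(x) p_k(y) + p_n(y) p_k(x)` for `k ≠ n`, and
`√2 p_n(x) p_n(y)` for `k = n`, where `p_j = p_j^{(α,β)}`. -/
def koornwinderSym (α β : ℝ) (k n : ℕ) : MvPolynomial (Fin 2) ℝ :=
  if k = n then
    MvPolynomial.C √2 *
      (aeval (MvPolynomial.X 0) (jacobiP α β n) * aeval (MvPolynomial.X 1) (jacobiP α β n))
  else
    aeval (MvPolynomial.X 0) (jacobiP α β n) * aeval (MvPolynomial.X 1) (jacobiP α β k) +
      aeval (MvPolynomial.X 1) (jacobiP α β n) * aeval (MvPolynomial.X 0) (jacobiP α β k)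

theorem koornwinderSym_isSymmetric (α β : ℝ) (k n : ℕ) :
    (koornwinderSym α β k n).IsSymmetric := by
  intro e
  have key : ∀ (i : Fin 2) (p : ℝ[X]),
      MvPolynomial.rename e (aeval (MvPolynomial.X i : MvPolynomial (Fin 2) ℝ) p) =
        aeval (MvPolynomial.X (e i) : MvPolynomial (Fin 2) ℝ) p := by
    intro i p
    rw [← Polynomial.aeval_algHom_apply, MvPolynomial.rename_X]
  have he : (e 0 = 0 ∧ e 1 = 1) ∨ (e 0 = 1 ∧ e 1 = 0) := by
    have h : e 0 ≠ e 1 := fun h => by simpa using e.injective h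
    generalize e 0 = a at h
    generalize e 1 = b at h
    revert a b
    decide
  unfold koornwinderSym
  split_ifs
  · simp only [map_mul, key, MvPolynomial.rename_C]
    rcases he with ⟨h0, h1⟩ | ⟨h0, h1⟩ <;> rw [h0, h1]
    ring
  · simp only [map_add, map_mul, key]
    rcases he with ⟨h0, h1⟩ | ⟨h0, h1⟩ <;> rw [h0, h1]
    ring

/-- The polynomial `P_{k,n}^{α,β,-1/2}(u, v)`: the unique polynomial with
`P_{k,n}(x + y, x y) = p_n(x) p_k(y) + p_n(y) p_k(x)` for `k ≠ n` and
`P_{n,n}(x + y, x y) = √2 p_n(x) p_n(y)`, obtained from the isomorphism between polynomials in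
the elementary symmetric polynomials and symmetric polynomials. -/
def koornwinder (α β : ℝ) (k n : ℕ) : MvPolynomial (Fin 2) ℝ :=
  (MvPolynomial.esymmAlgEquiv (Fin 2) ℝ (n := 2) (Fintype.card_fin 2)).symm
    ⟨koornwinderSym α β k n, koornwinderSym_isSymmetric α β k n⟩

/-- The defining property of `koornwinder`. -/
theorem aeval_koornwinder (α β : ℝ) (k n : ℕ) :
    MvPolynomial.aeval
      ![(MvPolynomial.X 0 + MvPolynomial.X 1 : MvPolynomial (Fin 2) ℝ),
        MvPolynomial.X 0 * MvPolynomial.X 1] (koornwinder α β k n) = koornwinderSym α β k n := by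
  have h := (MvPolynomial.esymmAlgEquiv (Fin 2) ℝ (n := 2) (Fintype.card_fin 2)).apply_symm_apply
    ⟨koornwinderSym α β k n, koornwinderSym_isSymmetric α β k n⟩
  have h2 := congrArg Subtype.val h
  rw [MvPolynomial.esymmAlgEquiv_apply, MvPolynomial.esymmAlgHom_apply] at h2
  have e1 : (fun i : Fin 2 => MvPolynomial.esymm (Fin 2) ℝ (i + 1)) =
      ![(MvPolynomial.X 0 + MvPolynomial.X 1 : MvPolynomial (Fin 2) ℝ),
        MvPolynomial.X 0 * MvPolynomial.X 1] := by
    funext i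
    fin_cases i
    · simp [MvPolynomial.esymm_one, Fin.sum_univ_two]
    · have : Finset.powersetCard 2 (Finset.univ : Finset (Fin 2)) = {Finset.univ} := by
        decide
      simp [MvPolynomial.esymm, this, Fin.prod_univ_two]
  rw [e1] at h2
  exact h2

/-- The substitution `P(u, v) ↦ P(2xy, x² + y² - 1)`. -/
def parabolicSubst (p : MvPolynomial (Fin 2) ℝ) : MvPolynomial (Fin 2) ℝ :=
  MvPolynomial.aeval
    ![2 * MvPolynomial.X 0 * MvPolynomial.X 1,
      MvPolynomial.X 0 ^ 2 + MvPolynomial.X 1 ^ 2 - 1] p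

/-- `₁Q_{k,2n}^{α,β,-1/2}(x, y) = P_{k,n}^{α,β,-1/2}(2xy, x² + y² - 1)`. -/
def evenQ₁ (α β : ℝ) (k n : ℕ) : MvPolynomial (Fin 2) ℝ :=
  parabolicSubst (koornwinder α β k n)

/-- `₂Q_{k,2n}^{α,β,-1/2}(x, y) = a^{(1,1)} (x² - y²) P_{k,n-1}^{α+1,β+1,-1/2}(2xy, x² + y² - 1)`
(used for `0 ≤ k ≤ n - 1`). -/
def evenQ₂ (α β : ℝ) (k n : ℕ) : MvPolynomial (Fin 2) ℝ :=
  MvPolynomial.C ((α + β + 2) * (α + β + 3) / (4 * (α + 1) * (β + 1))) *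
    (MvPolynomial.X 0 ^ 2 - MvPolynomial.X 1 ^ 2) *
      parabolicSubst (koornwinder (α + 1) (β + 1) k (n - 1))

/-- `₂Q_{k,2n+1}^{α,β,-1/2}(x, y) = a^{(1,0)} (x - y) P_{k,n}^{α+1,β,-1/2}(2xy, x² + y² - 1)`. -/
def oddQ₂ (α β : ℝ) (k n : ℕ) : MvPolynomial (Fin 2) ℝ :=
  MvPolynomial.C ((α + β + 2) / (2 * (α + 1))) *
    (MvPolynomial.X 0 - MvPolynomial.X 1) * parabolicSubst (koornwinder (α + 1) β k n)

/-- The column vector `ℚ_{2n}` with the entries `₁Q_{k,2n}`, `0 ≤ k ≤ n`, followed by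
`₂Q_{k,2n}`, `0 ≤ k ≤ n - 1`. -/
def vecQ (α β : ℝ) (n : ℕ) : Fin (n + 1) ⊕ Fin n → MvPolynomial (Fin 2) ℝ :=
  Sum.elim (fun k => evenQ₁ α β k n) (fun k => evenQ₂ α β k n)

/-- The weight function `𝓦_{α,β,-1/2}` on `[-1, 1]²`, up to a constant factor. -/
def squareWeight (α β x y : ℝ) : ℝ :=
  |x - y| ^ (2 * α + 1) * |x + y| ^ (2 * β + 1) *
    (1 - x ^ 2) ^ (-(1 / 2) : ℝ) * (1 - y ^ 2) ^ (-(1 / 2) : ℝ)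

/-- Orthogonality of two polynomials with respect to `𝓦_{α,β,-1/2}` on `[-1, 1]²` (the integral
converges and equals zero). -/
def SquareOrthogonal (α β : ℝ) (p q : MvPolynomial (Fin 2) ℝ) : Prop :=
  IntegrableOn (fun z : ℝ × ℝ => MvPolynomial.eval ![z.1, z.2] p * MvPolynomial.eval ![z.1, z.2] q *
      squareWeight α β z.1 z.2) (Set.Icc (-1) 1 ×ˢ Set.Icc (-1) 1) ∧
    ∫ z in Set.Icc (-1 : ℝ) 1 ×ˢ Set.Icc (-1 : ℝ) 1,
      MvPolynomial.eval ![z.1, z.2] p * MvPolynomial.eval ![z.1, z.2] q *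
        squareWeight α β z.1 z.2 = 0

/-- `p` is an orthogonal polynomial of degree `n`, that is, an element of
`𝓥_n(𝓦_{α,β,-1/2})`. -/
def IsOrthogonalPoly (α β : ℝ) (n : ℕ) (p : MvPolynomial (Fin 2) ℝ) : Prop :=
  p.totalDegree ≤ n ∧
    ∀ q : MvPolynomial (Fin 2) ℝ, q.totalDegree < n → SquareOrthogonal α β p q

/-- `p` is an `s`-orthogonal polynomial: it is orthogonal to all `q` with
`deg p + deg q ≤ s`. -/
def IsQuasiOrthogonal (α β : ℝ) (s : ℕ) (p : MvPolynomial (Fin 2) ℝ) : Prop :=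
  ∀ q : MvPolynomial (Fin 2) ℝ, p.totalDegree + q.totalDegree ≤ s → SquareOrthogonal α β p q

/-- The angles `0 = θ_{0,m} < θ_{1,m} < ⋯ < θ_{m,m} < π`, where `cos θ_{k,m}`, `1 ≤ k ≤ m`, are
the zeros of the Jacobi polynomial of degree `m` with parameters `α + 1, β`. -/
def nodeAngles (α β : ℝ) (m : ℕ) : Set ℝ :=
  {0} ∪ {θ | θ ∈ Set.Ioo 0 Real.pi ∧ (jacobiP (α + 1) β m).eval (Real.cos θ) = 0}

/-- The set `X_m` of the nodes `(s, t), (t, s), (-s, -t), (-t, -s)` of the near minimal cubature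
rule of degree `4m + 1`, where `s = cos ((θ_j - θ_k) / 2)` and `t = cos ((θ_j + θ_k) / 2)`,
`0 ≤ j ≤ k ≤ m`. -/
def nearMinNodes (α β : ℝ) (m : ℕ) : Set (Fin 2 → ℝ) :=
  {x | ∃ θ ∈ nodeAngles α β m, ∃ φ ∈ nodeAngles α β m, θ ≤ φ ∧
    ∃ s t : ℝ, s = Real.cos ((θ - φ) / 2) ∧ t = Real.cos ((θ + φ) / 2) ∧
      (x = ![s, t] ∨ x = ![t, s] ∨ x = ![-s, -t] ∨ x = ![-t, -s])}

/-- The entries of the vector `ℚ_{2m+2} + Γ ℚ_{2m}`. -/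
def vecQGamma (α β : ℝ) (m : ℕ)
    (Γ : Matrix (Fin (m + 2) ⊕ Fin (m + 1)) (Fin (m + 1) ⊕ Fin m) ℝ)
    (i : Fin (m + 2) ⊕ Fin (m + 1)) : MvPolynomial (Fin 2) ℝ :=
  vecQ α β (m + 1) i + ∑ j, MvPolynomial.C (Γ i j) * vecQ α β m j

/-- The ideal generated by `₂Q_{k,2m+1}`, `0 ≤ k ≤ m`, and the entries of
`ℚ_{2m+2} + Γ ℚ_{2m}`. -/
def nodeIdeal (α β : ℝ) (m : ℕ)
    (Γ : Matrix (Fin (m + 2) ⊕ Fin (m + 1)) (Fin (m + 1) ⊕ Fin m) ℝ) :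
    Ideal (MvPolynomial (Fin 2) ℝ) :=
  Ideal.span (Set.range (fun k : Fin (m + 1) => oddQ₂ α β k m) ∪ Set.range (vecQGamma α β m Γ))

end

noncomputable section

/-! Everything rests on the substitution 2xy = a + b, x² + y² - 1 = ab. It turns P_{k,n}(2xy, x² +
y² - 1) into the symmetrized product of p_n and p_k in a and b, and it gives (x - y)² = (1 - a)(1 -
b) and (x + y)² = (1 + a)(1 + b).

Orthogonality. For x = cos σ, y = cos τ one may take a = cos(σ + τ), b = cos(τ - σ). The
endomorphism (σ, τ) ↦ (σ + τ, τ - σ) of the torus preserves Haar measure, and the weight becomes a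
product of Jacobi weights in a and b (`torusWeight_eq`, `integral_torus_product`). A test polynomial
splits into parts (x - y)^i (x + y)^j G(a, b) with i, j ∈ {0, 1}. Only the part of matching parity
contributes, and its square factors shift α by i and β by j (`integral_parity_mul_eval_eq_zero`).
What remains is one-variable Jacobi orthogonality.

Variety. Let R = p_{m+1} + ρ p_m be the multiple of (1 - t) p_m^{(α+1,β)} given by
`exists_one_sub_X_mul_jacobiP`. Γ is chosen so that the first block of generators consists of
combinations of R(a) and R(b); this block alone forces R(a) = R(b) = 0
(`quasiJacobi_eq_zero_of_correctedSym_eq_zero`). Conversely, if a = 1 or b = 1 then x = y and the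
remaining generators vanish through their factor x - y. Otherwise a and b are zeros of
p_m^{(α+1,β)}, which kills the odd generators, and also the second block, because p_m^{(α+1,β)} is a
multiple of p_m + σ p_{m-1} for the parameters (α+1, β+1). Zeros of Jacobi polynomials are real and
lie in (-1, 1), so a and b are cosines of node angles, and (x, y) is then determined up to the four
symmetries of the node set. -/

theorem intervalIntegrable_jacobiWeight {α β : ℝ} (hα : -1 < α) (hβ : -1 < β) :
    IntervalIntegrable (jacobiWeight α β) volume (-1) 1 := by
  -- Splitting at 0 leaves one singular factor on each half.
  refine IntervalIntegrable.trans (b := 0) ?_ ?_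
  · have h1 : IntervalIntegrable (fun t : ℝ => (1 + t) ^ β) volume (-1) 0 := by
      have := (intervalIntegral.intervalIntegrable_rpow' (a := 0) (b := 1) hβ).comp_add_left 1
      simpa using this
    refine IntervalIntegrable.continuousOn_mul (f := fun t : ℝ => (1 + t) ^ β)
      (g := fun t : ℝ => (1 - t) ^ α) h1 ?_
    refine ContinuousOn.rpow_const (by fun_prop) fun t ht => Or.inl ?_
    rw [Set.uIcc_of_le (by norm_num)] at ht
    linarith [ht.2]
  · have h1 : IntervalIntegrable (fun t : ℝ => (1 - t) ^ α) volume 0 1 := by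
      have := (intervalIntegral.intervalIntegrable_rpow' (a := 1) (b := 0) hα).comp_sub_left 1
      simpa using this
    refine h1.mul_continuousOn (g := fun t : ℝ => (1 + t) ^ β) ?_
    refine ContinuousOn.rpow_const (by fun_prop) fun t ht => Or.inl ?_
    rw [Set.uIcc_of_le (by norm_num)] at ht
    linarith [ht.1]

theorem intervalIntegrable_eval_mul_jacobiWeight {α β : ℝ} (hα : -1 < α) (hβ : -1 < β)
    (p : ℝ[X]) :
    IntervalIntegrable (fun t => p.eval t * jacobiWeight α β t) volume (-1) 1 :=
  (intervalIntegrable_jacobiWeight hα hβ).continuousOn_mul p.continuous.continuousOn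

/-- Integration of a polynomial against the (unnormalized) Jacobi weight. -/
def jacobiIntegral (α β : ℝ) (p : ℝ[X]) : ℝ :=
  ∫ t in (-1 : ℝ)..1, p.eval t * jacobiWeight α β t

/-! ### Jacobi polynomials in one variable: orthogonality, connection relations, zeros -/

section Integral

variable {α β : ℝ}

theorem jacobiIntegral_add (hα : -1 < α) (hβ : -1 < β) (p q : ℝ[X]) :
    jacobiIntegral α β (p + q) = jacobiIntegral α β p + jacobiIntegral α β q := by
  unfold jacobiIntegral
  rw [← intervalIntegral.integral_add (intervalIntegrable_eval_mul_jacobiWeight hα hβ p)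
    (intervalIntegrable_eval_mul_jacobiWeight hα hβ q)]
  simp only [eval_add, add_mul]

theorem jacobiIntegral_C_mul (c : ℝ) (p : ℝ[X]) :
    jacobiIntegral α β (C c * p) = c * jacobiIntegral α β p := by
  unfold jacobiIntegral
  rw [← intervalIntegral.integral_const_mul]
  simp only [eval_mul, eval_C, mul_assoc]

theorem jacobiIntegral_zero : jacobiIntegral α β 0 = 0 := by simp [jacobiIntegral]

theorem jacobiIntegral_neg (p : ℝ[X]) : jacobiIntegral α β (-p) = -jacobiIntegral α β p := by
  simpa using jacobiIntegral_C_mul (α := α) (β := β) (-1) p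

theorem jacobiIntegral_sub (hα : -1 < α) (hβ : -1 < β) (p q : ℝ[X]) :
    jacobiIntegral α β (p - q) = jacobiIntegral α β p - jacobiIntegral α β q := by
  rw [sub_eq_add_neg, jacobiIntegral_add hα hβ, jacobiIntegral_neg, sub_eq_add_neg]

theorem jacobiIntegral_sum (hα : -1 < α) (hβ : -1 < β) {ι : Type*} (s : Finset ι)
    (f : ι → ℝ[X]) :
    jacobiIntegral α β (∑ i ∈ s, f i) = ∑ i ∈ s, jacobiIntegral α β (f i) := by
  classical
  induction s using Finset.induction_on with
  | empty => simp [jacobiIntegral_zero]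
  | insert a s ha ih => rw [Finset.sum_insert ha, Finset.sum_insert ha, jacobiIntegral_add hα hβ, ih]

theorem jacobiWeight_pos {t : ℝ} (ht : t ∈ Set.Ioo (-1 : ℝ) 1) : 0 < jacobiWeight α β t :=
  mul_pos (Real.rpow_pos_of_pos (by linarith [ht.2]) _)
    (Real.rpow_pos_of_pos (by linarith [ht.1]) _)

/-- The finitely many roots of p form a null set, and off them the integrand is positive on the open
interval. -/
theorem jacobiIntegral_pos (hα : -1 < α) (hβ : -1 < β) {p : ℝ[X]} (hp : p ≠ 0)
    (h : ∀ t ∈ Set.Ioo (-1 : ℝ) 1, 0 ≤ p.eval t) : 0 < jacobiIntegral α β p := by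
  have hc : ∀ t ∈ Set.Icc (-1 : ℝ) 1, 0 ≤ p.eval t := by
    have : Set.Icc (-1 : ℝ) 1 = closure (Set.Ioo (-1) 1) := (closure_Ioo (by norm_num)).symm
    rw [this]
    exact fun t ht => closure_minimal h (isClosed_le continuous_const p.continuous) ht
  unfold jacobiIntegral
  rw [intervalIntegral.integral_pos_iff_support_of_nonneg_ae' _
    (intervalIntegrable_eval_mul_jacobiWeight hα hβ p)]
  · refine ⟨by norm_num, ?_⟩
    have hsub : Set.Ioo (-1 : ℝ) 1 \ (p.roots.toFinset : Set ℝ) ⊆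
        Function.support (fun t => p.eval t * jacobiWeight α β t) ∩ Set.Ioc (-1) 1 := by
      rintro t ⟨ht, hr⟩
      refine ⟨mul_ne_zero ?_ (jacobiWeight_pos ht).ne', ht.1, ht.2.le⟩
      simpa [hp] using hr
    refine lt_of_lt_of_le ?_ (measure_mono hsub)
    rw [measure_sdiff_null (Finset.measure_zero _ _)]
    simp
  · refine (ae_restrict_iff' measurableSet_uIoc).2 (Filter.Eventually.of_forall fun t ht => ?_)
    rw [Set.uIoc_of_le (by norm_num)] at ht
    refine mul_nonneg (hc t ⟨ht.1.le, ht.2⟩) (mul_nonneg (Real.rpow_nonneg ?_ _)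
      (Real.rpow_nonneg ?_ _)) <;> linarith [ht.1, ht.2]

theorem jacobiIntegral_mul_self_pos (hα : -1 < α) (hβ : -1 < β) {p : ℝ[X]} (hp : p ≠ 0) :
    0 < jacobiIntegral α β (p * p) :=
  jacobiIntegral_pos hα hβ (mul_ne_zero hp hp) fun t _ => by
    rw [eval_mul]; exact mul_self_nonneg _

theorem jacobiWeight_add_one_left {t : ℝ} (hα : -1 < α) (ht : t ≤ 1) :
    jacobiWeight (α + 1) β t = (1 - t) * jacobiWeight α β t := by
  unfold jacobiWeight
  -- At t = 1 both sides vanish because α + 1 > 0, whatever value is assigned to 0 ^ α.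
  rcases eq_or_lt_of_le (sub_nonneg.2 ht) with h | h
  · rw [← h, Real.zero_rpow (by linarith)]; simp
  · rw [Real.rpow_add_one h.ne']; ring

theorem jacobiWeight_add_one_right {t : ℝ} (hβ : -1 < β) (ht : -1 ≤ t) :
    jacobiWeight α (β + 1) t = (1 + t) * jacobiWeight α β t := by
  unfold jacobiWeight
  rcases eq_or_lt_of_le (show 0 ≤ 1 + t by linarith) with h | h
  · rw [← h, Real.zero_rpow (by linarith)]; simp
  · rw [Real.rpow_add_one h.ne']; ring

theorem jacobiIntegral_one_sub_X_mul (hα : -1 < α) (p : ℝ[X]) :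
    jacobiIntegral α β ((1 - X) * p) = jacobiIntegral (α + 1) β p := by
  unfold jacobiIntegral
  refine intervalIntegral.integral_congr fun t ht => ?_
  rw [Set.uIcc_of_le (by norm_num)] at ht
  simp only [jacobiWeight_add_one_left hα ht.2, eval_mul, eval_sub, eval_one, eval_X]
  ring

theorem jacobiIntegral_one_add_X_mul (hβ : -1 < β) (p : ℝ[X]) :
    jacobiIntegral α β ((1 + X) * p) = jacobiIntegral α (β + 1) p := by
  unfold jacobiIntegral
  refine intervalIntegral.integral_congr fun t ht => ?_
  rw [Set.uIcc_of_le (by norm_num)] at ht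
  simp only [jacobiWeight_add_one_right hβ ht.1, eval_mul, eval_add, eval_one, eval_X]
  ring

theorem jacobiInner_eq (p q : ℝ[X]) :
    jacobiInner α β p q = jacobiIntegral α β (p * q) / jacobiIntegral α β 1 := by
  simp [jacobiInner, jacobiIntegral]

theorem jacobiMonic_monic_and_degree (n : ℕ) :
    (jacobiMonic α β n).Monic ∧ (jacobiMonic α β n).degree = n := by
  induction n using Nat.strong_induction_on with
  | _ n ih =>
    rw [jacobiMonic]
    have hd : (∑ i : Fin n, C (jacobiInner α β (X ^ n) (jacobiMonic α β i) /
        jacobiInner α β (jacobiMonic α β i) (jacobiMonic α β i)) * jacobiMonic α β i).degree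
        < (n : WithBot ℕ) := by
      refine lt_of_le_of_lt (degree_sum_le _ _) ((Finset.sup_lt_iff (WithBot.bot_lt_coe n)).2 ?_)
      intro i _
      rw [C_mul']
      refine lt_of_le_of_lt (degree_smul_le _ _) ?_
      rw [(ih i i.2).2]
      exact Nat.cast_lt.2 i.2
    have hX : (X ^ n : ℝ[X]).degree = n := degree_X_pow n
    refine ⟨?_, by rw [degree_sub_eq_left_of_degree_lt (by rwa [hX]), hX]⟩
    exact (monic_X_pow n).sub_of_left (by rwa [hX])

theorem jacobiMonic_ne_zero (n : ℕ) : jacobiMonic α β n ≠ 0 :=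
  (jacobiMonic_monic_and_degree n).1.ne_zero

theorem jacobiIntegral_jacobiMonic_mul_jacobiMonic (hα : -1 < α) (hβ : -1 < β) (n : ℕ) :
    ∀ k < n, jacobiIntegral α β (jacobiMonic α β n * jacobiMonic α β k) = 0 := by
  induction n using Nat.strong_induction_on with
  | _ n ih =>
    intro k hk
    have h1 : 0 < jacobiIntegral α β 1 := jacobiIntegral_pos hα hβ one_ne_zero (by simp)
    rw [jacobiMonic, sub_mul, jacobiIntegral_sub hα hβ, Finset.sum_mul,
      jacobiIntegral_sum hα hβ, Finset.sum_eq_single (⟨k, hk⟩ : Fin n)]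
    · have hk0 := (jacobiIntegral_mul_self_pos hα hβ (jacobiMonic_ne_zero (α := α) (β := β) k)).ne'
      simp only [mul_assoc, jacobiIntegral_C_mul, jacobiInner_eq]
      field_simp
      ring
    · intro i _ hi
      rw [mul_assoc, jacobiIntegral_C_mul]
      rcases lt_or_gt_of_ne (fun h => hi (Fin.ext h) : (i : ℕ) ≠ k) with h | h
      · rw [mul_comm (jacobiMonic α β i), ih k hk i h, mul_zero]
      · rw [ih i i.2 k h, mul_zero]
    · simp

/-- One step of the expansion in a monic basis; iterating it carries orthogonality from the basis to
all polynomials of lower degree. -/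
theorem degree_sub_C_coeff_mul_lt {p q : ℝ[X]} {d : ℕ} (hq : q.Monic) (hqd : q.degree = d)
    (hp : p.degree < (d + 1 : ℕ)) : (p - C (p.coeff d) * q).degree < d := by
  have hqn : q.natDegree = d := natDegree_eq_of_degree_eq_some hqd
  rw [degree_lt_iff_coeff_zero] at hp ⊢
  intro j hj
  rw [coeff_sub, coeff_C_mul]
  rcases eq_or_lt_of_le hj with rfl | h
  · rw [← hqn, hq.coeff_natDegree]; simp
  · rw [hp j h, coeff_eq_zero_of_natDegree_lt (p := q) (by omega)]; simp

theorem jacobiIntegral_jacobiMonic_mul (hα : -1 < α) (hβ : -1 < β) {n : ℕ} {p : ℝ[X]}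
    (hp : p.degree < n) : jacobiIntegral α β (jacobiMonic α β n * p) = 0 := by
  suffices ∀ d ≤ n, ∀ p : ℝ[X], p.degree < d →
      jacobiIntegral α β (jacobiMonic α β n * p) = 0 from this n le_rfl p hp
  intro d
  induction d with
  | zero =>
    intro _ p hp
    have : p = 0 := by simpa using hp
    simp [this, jacobiIntegral_zero]
  | succ d ih =>
    intro hd p hp
    obtain ⟨hm, hdeg⟩ := jacobiMonic_monic_and_degree (α := α) (β := β) d
    have h := ih (by omega) _ (degree_sub_C_coeff_mul_lt hm hdeg hp)
    rw [mul_sub, jacobiIntegral_sub hα hβ, mul_left_comm, jacobiIntegral_C_mul,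
      jacobiIntegral_jacobiMonic_mul_jacobiMonic hα hβ n d (by omega)] at h
    linarith

theorem jacobiInner_self_pos (hα : -1 < α) (hβ : -1 < β) {p : ℝ[X]} (hp : p ≠ 0) :
    0 < jacobiInner α β p p := by
  rw [jacobiInner_eq]
  exact div_pos (jacobiIntegral_mul_self_pos hα hβ hp)
    (jacobiIntegral_pos hα hβ one_ne_zero (by simp))

theorem jacobiP_eq (hα : -1 < α) (hβ : -1 < β) (n : ℕ) :
    ∃ c ≠ 0, jacobiP α β n = C c * jacobiMonic α β n :=
  ⟨_, inv_ne_zero (Real.sqrt_ne_zero'.2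
    (jacobiInner_self_pos hα hβ (jacobiMonic_ne_zero n))), rfl⟩

theorem degree_jacobiP (hα : -1 < α) (hβ : -1 < β) (n : ℕ) : (jacobiP α β n).degree = n := by
  obtain ⟨c, hc, h⟩ := jacobiP_eq hα hβ n
  rw [h, degree_C_mul hc, (jacobiMonic_monic_and_degree n).2]

theorem jacobiP_ne_zero (hα : -1 < α) (hβ : -1 < β) (n : ℕ) : jacobiP α β n ≠ 0 := by
  intro h
  simpa [h] using degree_jacobiP hα hβ n

theorem jacobiIntegral_jacobiP_mul (hα : -1 < α) (hβ : -1 < β) {n : ℕ} {p : ℝ[X]}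
    (hp : p.degree < n) : jacobiIntegral α β (jacobiP α β n * p) = 0 := by
  obtain ⟨c, -, h⟩ := jacobiP_eq hα hβ n
  rw [h, mul_assoc, jacobiIntegral_C_mul, jacobiIntegral_jacobiMonic_mul hα hβ hp, mul_zero]

/-- A polynomial of degree `n + 1` orthogonal to all polynomials of degree less than `n` is a
combination of the two Jacobi polynomials of degrees `n + 1` and `n`. -/
theorem exists_eq_jacobiP_succ_add (hα : -1 < α) (hβ : -1 < β) {n : ℕ} {p : ℝ[X]}
    (hd : p.degree = (n + 1 : ℕ))
    (hp : ∀ q : ℝ[X], q.degree < n → jacobiIntegral α β (p * q) = 0) :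
    ∃ c ≠ 0, ∃ ρ, p = C c * (jacobiP α β (n + 1) + C ρ * jacobiP α β n) := by
  obtain ⟨c₁, hc₁, h₁⟩ := jacobiP_eq hα hβ (n + 1)
  obtain ⟨c₀, hc₀, h₀⟩ := jacobiP_eq hα hβ n
  obtain ⟨hm₁, hdeg₁⟩ := jacobiMonic_monic_and_degree (α := α) (β := β) (n + 1)
  obtain ⟨hm₀, hdeg₀⟩ := jacobiMonic_monic_and_degree (α := α) (β := β) n
  set a := p.coeff (n + 1) with ha
  have ha0 : a ≠ 0 := by
    rw [ha, ← natDegree_eq_of_degree_eq_some hd]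
    simp only [coeff_natDegree, ne_eq, leadingCoeff_eq_zero]
    intro h
    rw [h, degree_zero] at hd
    exact WithBot.bot_ne_coe hd
  have l1 : (p - C a * jacobiMonic α β (n + 1)).degree < (n + 1 : ℕ) :=
    degree_sub_C_coeff_mul_lt hm₁ hdeg₁ (by rw [hd]; exact_mod_cast Nat.lt_succ_self _)
  have l2 := degree_sub_C_coeff_mul_lt hm₀ hdeg₀ l1
  set b := (p - C a * jacobiMonic α β (n + 1)).coeff n
  set r := p - C a * jacobiMonic α β (n + 1) - C b * jacobiMonic α β n with hr
  -- The remainder has degree less than n, so it is orthogonal to p and to both monic polynomials,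
  -- hence to itself.
  have hr0 : r = 0 := by
    by_contra h
    have hpos := jacobiIntegral_mul_self_pos hα hβ h
    have : r * r = p * r - C a * (jacobiMonic α β (n + 1) * r) - C b * (jacobiMonic α β n * r) := by
      nth_rewrite 1 [hr]; ring
    rw [this, jacobiIntegral_sub hα hβ, jacobiIntegral_sub hα hβ, hp r l2, jacobiIntegral_C_mul,
      jacobiIntegral_C_mul, jacobiIntegral_jacobiMonic_mul hα hβ l2,
      jacobiIntegral_jacobiMonic_mul hα hβ (l2.trans (by exact_mod_cast Nat.lt_succ_self _))] at hpos
    simp at hpos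
  -- The coefficients a, b in the monic basis, rescaled by the normalizing factors c₁, c₀.
  refine ⟨a / c₁, div_ne_zero ha0 hc₁, b * c₁ / (a * c₀), ?_⟩
  have hpe : p = C a * jacobiMonic α β (n + 1) + C b * jacobiMonic α β n := by
    rw [hr] at hr0; linear_combination hr0
  rw [hpe, h₁, h₀, mul_add, ← mul_assoc, ← mul_assoc, ← mul_assoc, ← C_mul, ← C_mul, ← C_mul]
  congr 3
  · field_simp
  · field_simp

/-- The factor 1 - X trades the weight (α, β) for (α + 1, β), so the product inherits orthogonality
to degrees below n. This supplies the ρ of the first block of Γ. -/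
theorem exists_one_sub_X_mul_jacobiP (hα : -1 < α) (hβ : -1 < β) (n : ℕ) :
    ∃ c ≠ 0, ∃ ρ, (1 - X) * jacobiP (α + 1) β n =
      C c * (jacobiP α β (n + 1) + C ρ * jacobiP α β n) := by
  have hα' : -1 < α + 1 := by linarith
  refine exists_eq_jacobiP_succ_add hα hβ ?_ fun q hq => ?_
  · have : (1 - X : ℝ[X]) = -(X - C 1) := by simp
    rw [degree_mul, degree_jacobiP hα' hβ, this, degree_neg, degree_X_sub_C, add_comm]
    rfl
  · rw [mul_assoc, jacobiIntegral_one_sub_X_mul hα, jacobiIntegral_jacobiP_mul hα' hβ hq]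

/-- Against the weight (α, β + 1), a test polynomial q of degree below n becomes (1 + X) q, still of
degree below n + 1. Used with α + 1 for α, this supplies the σ of the second block of Γ. -/
theorem exists_jacobiP_succ_eq (hα : -1 < α) (hβ : -1 < β) (n : ℕ) :
    ∃ c ≠ 0, ∃ ρ, jacobiP α β (n + 1) =
      C c * (jacobiP α (β + 1) (n + 1) + C ρ * jacobiP α (β + 1) n) := by
  have hβ' : -1 < β + 1 := by linarith
  refine exists_eq_jacobiP_succ_add hα hβ' (degree_jacobiP hα hβ _) fun q hq => ?_
  rw [← jacobiIntegral_one_add_X_mul hβ, mul_left_comm, jacobiIntegral_jacobiP_mul hα hβ]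
  have h1 : (1 + X : ℝ[X]).degree = 1 := by
    rw [add_comm, ← C_1, degree_X_add_C]
  by_cases h0 : q = 0
  · simp [h0]
  · rw [degree_mul, h1, degree_eq_natDegree h0] at *
    norm_cast at *
    omega

/-- Write p = (X - x) g. Then p is orthogonal to g, whereas p g = (X - x) g² would have constant
sign on the interval if x lay outside it. -/
theorem mem_Ioo_of_eval_jacobiP_eq_zero (hα : -1 < α) (hβ : -1 < β) {n : ℕ} {x : ℝ}
    (h : (jacobiP α β n).eval x = 0) : x ∈ Set.Ioo (-1 : ℝ) 1 := by
  obtain ⟨g, hg⟩ := dvd_iff_isRoot.2 h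
  have hp := jacobiP_ne_zero hα hβ n
  have hg0 : g ≠ 0 := by rintro rfl; simp [hg] at hp
  have hX : (X - C x) ≠ 0 := X_sub_C_ne_zero x
  have hdeg : g.degree < n := by
    rw [← degree_jacobiP hα hβ n, hg, degree_mul, degree_X_sub_C, degree_eq_natDegree hg0]
    norm_cast
    omega
  have h0 := jacobiIntegral_jacobiP_mul hα hβ hdeg
  by_contra hx
  rcases le_or_gt x (-1) with h1 | h1
  · have := jacobiIntegral_pos hα hβ (p := (jacobiP α β n) * g) (mul_ne_zero hp hg0)
      fun t ht => by
        rw [hg]; simp only [eval_mul, eval_sub, eval_X, eval_C]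
        have : 0 ≤ t - x := by linarith [ht.1]
        rw [mul_assoc]; exact mul_nonneg this (mul_self_nonneg _)
    linarith
  · have h2 : 1 ≤ x := by by_contra h2; exact hx ⟨h1, not_le.1 h2⟩
    have := jacobiIntegral_pos hα hβ (p := -((jacobiP α β n) * g)) (neg_ne_zero.2 (mul_ne_zero hp hg0))
      fun t ht => by
        rw [hg]; simp only [eval_mul, eval_sub, eval_X, eval_C, eval_neg]
        have : 0 ≤ x - t := by linarith [ht.2]
        nlinarith [mul_nonneg this (mul_self_nonneg (eval t g))]
    rw [jacobiIntegral_neg] at this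
    linarith

/-- All complex zeros of a Jacobi polynomial are real and lie in `(-1, 1)`. -/
theorem exists_ofReal_eq_of_aeval_jacobiP_eq_zero (hα : -1 < α) (hβ : -1 < β) {n : ℕ} {z : ℂ}
    (h : aeval z (jacobiP α β n) = 0) :
    ∃ x ∈ Set.Ioo (-1 : ℝ) 1, (jacobiP α β n).eval x = 0 ∧ z = x := by
  by_cases him : z.im = 0
  · have hz : z = (z.re : ℂ) := Complex.ext rfl (by simpa using him)
    have h0 : (jacobiP α β n).eval z.re = 0 := by
      rw [hz, ← Complex.coe_algebraMap, aeval_algebraMap_apply] at h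
      simpa using h
    exact ⟨z.re, mem_Ioo_of_eval_jacobiP_eq_zero hα hβ h0, h0, hz⟩
  · exfalso
    -- Same argument with the real factor (X - z)(X - z̄), which is nonnegative on ℝ.
    obtain ⟨g, hg⟩ := quadratic_dvd_of_aeval_eq_zero_im_ne_zero _ h him
    have hp := jacobiP_ne_zero hα hβ n
    have hg0 : g ≠ 0 := by rintro rfl; simp [hg] at hp
    have hquad : (X ^ 2 - C (2 * z.re) * X + C (‖z‖ ^ 2) : ℝ[X]).degree = 2 := by
      compute_degree!
    have hdeg : g.degree < n := by
      rw [← degree_jacobiP hα hβ n, hg, degree_mul, hquad, degree_eq_natDegree hg0]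
      norm_cast
      omega
    have h0 := jacobiIntegral_jacobiP_mul hα hβ hdeg
    have := jacobiIntegral_pos hα hβ (p := (jacobiP α β n) * g) (mul_ne_zero hp hg0)
      fun t _ => by
        rw [hg]
        simp only [eval_mul, eval_sub, eval_add, eval_pow, eval_X, eval_C]
        have : 0 ≤ t ^ 2 - 2 * z.re * t + ‖z‖ ^ 2 := by
          rw [Complex.sq_norm, Complex.normSq_apply]
          nlinarith [sq_nonneg (t - z.re), sq_nonneg z.im]
        rw [mul_assoc]; exact mul_nonneg this (mul_self_nonneg _)
    linarith

end Integral

/-! ### From the square to the torus, and rotation of the torus -/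

section ChangeOfVariables

open Set
open scoped NNReal ENNReal

instance fact_two_pi_pos : Fact (0 < 2 * Real.pi) := ⟨Real.two_pi_pos⟩

/-- The cosine as a function on the circle. -/
def circleCos (t : AddCircle (2 * Real.pi)) : ℝ := Real.cos_periodic.lift t

theorem continuous_circleCos : Continuous circleCos :=
  continuous_coinduced_dom.2 Real.continuous_cos

/-- The density of the image of the length measure of the circle under the cosine. -/
def arcsineDensity (x : ℝ) : ℝ≥0 := 2 * .mk (√(1 - x ^ 2)⁻¹) (by positivity)

theorem measurable_arcsineDensity : Measurable arcsineDensity := by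
  unfold arcsineDensity; fun_prop

theorem measurable_arcsineDensity_mul :
    Measurable fun z : ℝ × ℝ => arcsineDensity z.1 * arcsineDensity z.2 := by
  have := measurable_arcsineDensity
  fun_prop

/-- Each of the two half-circles is mapped by the cosine to the Chebyshev measure; evenness of the
cosine accounts for the factor 2 in the density. -/
theorem map_circleCos :
    (volume : Measure (AddCircle (2 * Real.pi))).map circleCos =
      (volume.restrict (Ioc (-1) 1)).withDensity fun x => (arcsineDensity x : ℝ≥0∞) := by
  have hT : (volume.restrict (Ioc (-1) 1)).withDensity (fun x => (arcsineDensity x : ℝ≥0∞)) =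
      (2 : ℝ≥0∞) • Chebyshev.measureT := by
    rw [Chebyshev.measureT, restrict_withDensity measurableSet_Ioc, ← withDensity_smul]
    · rfl
    · fun_prop
  have hfin : IsFiniteMeasure Chebyshev.measureT :=
    (integrable_const_iff_isFiniteMeasure (one_ne_zero (α := ℝ))).1
      (Chebyshev.integrable_measureT continuousOn_const)
  rw [hT]
  ext s hs
  have hmk := AddCircle.measurePreserving_mk (2 * Real.pi) (-Real.pi)
  rw [← hmk.map_eq, Measure.map_map continuous_circleCos.measurable hmk.measurable]
  have hcomp : circleCos ∘ ((↑) : ℝ → AddCircle (2 * Real.pi)) = Real.cos := rfl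
  rw [hcomp, show -Real.pi + 2 * Real.pi = Real.pi by ring]
  have hf : ∀ a b : ℝ, IntervalIntegrable (fun θ => s.indicator (1 : ℝ → ℝ) (Real.cos θ))
      volume a b := by
    intro a b
    refine (intervalIntegrable_const (c := (1 : ℝ))).mono_fun
      (((measurable_one.indicator hs).comp Real.measurable_cos).aestronglyMeasurable) ?_
    refine Filter.Eventually.of_forall fun θ => ?_
    by_cases h : Real.cos θ ∈ s <;> simp [h]
  have h1 : ∫ x, s.indicator (1 : ℝ → ℝ) x ∂((volume.restrict (Ioc (-Real.pi) Real.pi)).map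
      Real.cos) = 2 * ∫ x, s.indicator (1 : ℝ → ℝ) x ∂Chebyshev.measureT := by
    rw [integral_map Real.measurable_cos.aemeasurable
      (measurable_one.indicator hs).aestronglyMeasurable,
      Chebyshev.integral_measureT_eq_integral_cos,
      ← intervalIntegral.integral_of_le (by linarith [Real.pi_pos]),
      ← intervalIntegral.integral_add_adjacent_intervals (hf _ 0) (hf 0 _)]
    have := intervalIntegral.integral_comp_neg (a := 0) (b := Real.pi)
      fun θ => s.indicator (1 : ℝ → ℝ) (Real.cos θ)
    simp only [Real.cos_neg, neg_zero] at this
    rw [← this]; ring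
  rw [integral_indicator_one hs, integral_indicator_one hs] at h1
  rw [Measure.smul_apply, ← ENNReal.toReal_eq_toReal_iff' (measure_ne_top _ _)
    (by simpa using ENNReal.mul_ne_top (by simp) (measure_ne_top _ _))]
  simpa [Measure.real] using h1

theorem integral_circleCos {f : ℝ → ℝ} (hf : Measurable f) :
    ∫ t, f (circleCos t) = 2 * ∫ x in (-1 : ℝ)..1, f x * √(1 - x ^ 2)⁻¹ := by
  rw [← integral_map continuous_circleCos.measurable.aemeasurable hf.aestronglyMeasurable,
    map_circleCos, integral_withDensity_eq_integral_smul measurable_arcsineDensity,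
    intervalIntegral.integral_of_le (by norm_num), ← integral_const_mul]
  refine integral_congr_ae (Filter.Eventually.of_forall fun x => ?_)
  simp only [arcsineDensity, NNReal.smul_def, smul_eq_mul, NNReal.coe_mul, NNReal.coe_ofNat,
    NNReal.coe_mk]
  ring

theorem integrable_circleCos {f : ℝ → ℝ} (hf : Measurable f)
    (h : IntervalIntegrable (fun x => f x * √(1 - x ^ 2)⁻¹) volume (-1) 1) :
    Integrable fun t => f (circleCos t) := by
  refine (integrable_map_measure hf.aestronglyMeasurable
    continuous_circleCos.measurable.aemeasurable).1 ?_
  rw [map_circleCos, integrable_withDensity_iff_integrable_smul measurable_arcsineDensity]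
  rw [intervalIntegrable_iff_integrableOn_Ioc_of_le (by norm_num)] at h
  refine (h.const_mul 2).congr (Filter.Eventually.of_forall fun x => ?_)
  simp only [arcsineDensity, NNReal.smul_def, smul_eq_mul, NNReal.coe_mul, NNReal.coe_ofNat,
    NNReal.coe_mk]
  ring

/-- The two-dimensional torus. -/
abbrev Torus := AddCircle (2 * Real.pi) × AddCircle (2 * Real.pi)

theorem map_prod_circleCos :
    (volume : Measure Torus).map (Prod.map circleCos circleCos) =
      (volume.restrict (Ioc (-1 : ℝ) 1 ×ˢ Ioc (-1 : ℝ) 1)).withDensity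
        fun z => ((arcsineDensity z.1 * arcsineDensity z.2 : ℝ≥0) : ℝ≥0∞) := by
  rw [Measure.volume_eq_prod, ← Measure.map_prod_map _ _ continuous_circleCos.measurable
    continuous_circleCos.measurable, map_circleCos, prod_withDensity,
    Measure.prod_restrict, Measure.volume_eq_prod]
  · rfl
  · exact measurable_arcsineDensity.coe_nnreal_ennreal
  · exact measurable_arcsineDensity.coe_nnreal_ennreal

theorem restrict_square_ae_eq :
    (volume : Measure (ℝ × ℝ)).restrict (Icc (-1) 1 ×ˢ Icc (-1) 1) =
      volume.restrict (Ioc (-1) 1 ×ˢ Ioc (-1) 1) := by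
  refine Measure.restrict_congr_set ?_
  rw [Measure.volume_eq_prod]
  exact (Measure.set_prod_ae_eq Ioc_ae_eq_Icc Ioc_ae_eq_Icc).symm

theorem arcsineDensity_mul (x y : ℝ) (hx : x ∈ Ioc (-1 : ℝ) 1) (hy : y ∈ Ioc (-1 : ℝ) 1) :
    ((arcsineDensity x * arcsineDensity y : ℝ≥0) : ℝ) =
      4 * ((1 - x ^ 2) ^ (-(1 / 2) : ℝ) * (1 - y ^ 2) ^ (-(1 / 2) : ℝ)) := by
  have h : ∀ x ∈ Ioc (-1 : ℝ) 1, √(1 - x ^ 2)⁻¹ = (1 - x ^ 2) ^ (-(1 / 2) : ℝ) := by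
    intro x hx
    rw [Real.rpow_neg (by nlinarith [hx.1, hx.2]), ← Real.sqrt_eq_rpow, Real.sqrt_inv]
  simp only [arcsineDensity, NNReal.coe_mul, NNReal.coe_ofNat, NNReal.coe_mk, h x hx, h y hy]
  ring

/-- The weight on the torus corresponding to `squareWeight`. -/
def torusWeight (α β : ℝ) (s : Torus) : ℝ :=
  |circleCos s.1 - circleCos s.2| ^ (2 * α + 1) * |circleCos s.1 + circleCos s.2| ^ (2 * β + 1)

theorem integral_square {α β : ℝ} {f : ℝ × ℝ → ℝ} (hf : Continuous f) :
    ∫ s : Torus, f (circleCos s.1, circleCos s.2) * torusWeight α β s =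
      4 * ∫ z in Icc (-1 : ℝ) 1 ×ˢ Icc (-1 : ℝ) 1, f z * squareWeight α β z.1 z.2 := by
  have hm : Measurable fun z : ℝ × ℝ =>
      f z * (|z.1 - z.2| ^ (2 * α + 1) * |z.1 + z.2| ^ (2 * β + 1)) := by
    have := hf.measurable
    fun_prop
  have h := integral_map (μ := (volume : Measure Torus))
    (φ := Prod.map circleCos circleCos)
    (continuous_circleCos.prodMap continuous_circleCos).measurable.aemeasurable
    hm.aestronglyMeasurable
  refine h.symm.trans ?_
  rw [map_prod_circleCos, integral_withDensity_eq_integral_smul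
    measurable_arcsineDensity_mul, restrict_square_ae_eq, ← integral_const_mul]
  refine setIntegral_congr_fun (measurableSet_Ioc.prod measurableSet_Ioc) fun z hz => ?_
  simp only [NNReal.smul_def, smul_eq_mul, arcsineDensity_mul _ _ hz.1 hz.2, squareWeight]
  ring

theorem integrableOn_square {α β : ℝ} {f : ℝ × ℝ → ℝ} (hf : Continuous f)
    (hw : Integrable (torusWeight α β)) :
    IntegrableOn (fun z => f z * squareWeight α β z.1 z.2) (Icc (-1 : ℝ) 1 ×ˢ Icc (-1 : ℝ) 1) := by
  refine IntegrableOn.continuousOn_mul hf.continuousOn ?_ (isCompact_Icc.prod isCompact_Icc)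
  have hm : Measurable fun z : ℝ × ℝ =>
      (|z.1 - z.2| ^ (2 * α + 1) * |z.1 + z.2| ^ (2 * β + 1)) := by
    fun_prop
  have h := (integrable_map_measure (μ := (volume : Measure Torus))
    (f := Prod.map circleCos circleCos) hm.aestronglyMeasurable
    (continuous_circleCos.prodMap continuous_circleCos).measurable.aemeasurable).2 hw
  rw [map_prod_circleCos, integrable_withDensity_iff_integrable_smul
    measurable_arcsineDensity_mul] at h
  rw [IntegrableOn, restrict_square_ae_eq]
  refine (h.const_mul (1 / 4)).congr ((ae_restrict_iff' (measurableSet_Ioc.prod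
    measurableSet_Ioc)).2 (Filter.Eventually.of_forall fun z hz => ?_))
  simp only [NNReal.smul_def, smul_eq_mul, arcsineDensity_mul _ _ hz.1 hz.2, squareWeight]
  ring

/-- The endomorphism `(σ, τ) ↦ (σ + τ, τ - σ)` of the torus. -/
def torusRotation : Torus →+ Torus where
  toFun s := (s.1 + s.2, s.2 - s.1)
  map_zero' := by simp
  map_add' s t := by ext <;> simp only [Prod.fst_add, Prod.snd_add] <;> abel

/-- A continuous surjective endomorphism of a compact group preserves Haar measure. The determinant
2 is offset by the map being two-to-one. -/
theorem measurePreserving_torusRotation : MeasurePreserving torusRotation := by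
  have : (volume : Measure Torus).IsAddHaarMeasure := by
    rw [Measure.volume_eq_prod]; infer_instance
  refine AddMonoidHom.measurePreserving (f := torusRotation) ?_ ?_ rfl
  · change Continuous fun s : Torus => (s.1 + s.2, s.2 - s.1)
    fun_prop
  · rintro ⟨θ, φ⟩
    induction θ using QuotientAddGroup.induction_on with | _ θ => ?_
    induction φ using QuotientAddGroup.induction_on with | _ φ => ?_
    refine ⟨(((θ - φ) / 2 : ℝ), ((θ + φ) / 2 : ℝ)), Prod.ext ?_ ?_⟩
    · change (((θ - φ) / 2 : ℝ) : AddCircle (2 * Real.pi)) + ((θ + φ) / 2 : ℝ) = θ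
      rw [← AddCircle.coe_add]; congr 1; ring
    · change (((θ + φ) / 2 : ℝ) : AddCircle (2 * Real.pi)) - ((θ - φ) / 2 : ℝ) = φ
      rw [← AddCircle.coe_sub]; congr 1; ring

theorem circleCos_mul_circleCos (s : Torus) :
    2 * circleCos s.1 * circleCos s.2 =
      circleCos (torusRotation s).1 + circleCos (torusRotation s).2 := by
  obtain ⟨σ, τ⟩ := s
  induction σ using QuotientAddGroup.induction_on with | _ σ => ?_
  induction τ using QuotientAddGroup.induction_on with | _ τ => ?_
  change 2 * Real.cos σ * Real.cos τ = Real.cos (σ + τ) + Real.cos (τ - σ)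
  rw [Real.cos_add, Real.cos_sub]; ring

theorem circleCos_sq_add_sq (s : Torus) :
    circleCos s.1 ^ 2 + circleCos s.2 ^ 2 - 1 =
      circleCos (torusRotation s).1 * circleCos (torusRotation s).2 := by
  obtain ⟨σ, τ⟩ := s
  induction σ using QuotientAddGroup.induction_on with | _ σ => ?_
  induction τ using QuotientAddGroup.induction_on with | _ τ => ?_
  change Real.cos σ ^ 2 + Real.cos τ ^ 2 - 1 = Real.cos (σ + τ) * Real.cos (τ - σ)
  rw [Real.cos_add, Real.cos_sub]
  linear_combination (1 - Real.cos σ ^ 2) * Real.sin_sq_add_cos_sq τ +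
    Real.sin τ ^ 2 * Real.sin_sq_add_cos_sq σ

theorem circleCos_mem (t : AddCircle (2 * Real.pi)) : circleCos t ∈ Icc (-1 : ℝ) 1 := by
  induction t using QuotientAddGroup.induction_on with | _ t => ?_
  exact ⟨Real.neg_one_le_cos t, Real.cos_le_one t⟩

/-- The Jacobi weight multiplied by `√(1 - t²)`. -/
def jacobiArcsineWeight (α β t : ℝ) : ℝ := (1 - t) ^ (α + 1 / 2) * (1 + t) ^ (β + 1 / 2)

theorem measurable_jacobiArcsineWeight (α β : ℝ) : Measurable (jacobiArcsineWeight α β) := by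
  unfold jacobiArcsineWeight; fun_prop

theorem abs_rpow_two_mul_add_one (z γ : ℝ) : |z| ^ (2 * γ + 1) = (z ^ 2) ^ (γ + 1 / 2) := by
  rw [← sq_abs, ← Real.rpow_natCast, ← Real.rpow_mul (abs_nonneg z)]
  congr 1; push_cast; ring

/-- (x - y)² = (1 - a)(1 - b) and (x + y)² = (1 + a)(1 + b), so the weight separates in the rotated
variables. -/
theorem torusWeight_eq (α β : ℝ) (s : Torus) :
    torusWeight α β s = jacobiArcsineWeight α β (circleCos (torusRotation s).1) *
      jacobiArcsineWeight α β (circleCos (torusRotation s).2) := by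
  have h1 := circleCos_mul_circleCos s
  have h2 := circleCos_sq_add_sq s
  have ha := circleCos_mem (torusRotation s).1
  have hb := circleCos_mem (torusRotation s).2
  set a := circleCos (torusRotation s).1
  set b := circleCos (torusRotation s).2
  have e1 : (circleCos s.1 - circleCos s.2) ^ 2 = (1 - a) * (1 - b) := by
    linear_combination h2 - h1
  have e2 : (circleCos s.1 + circleCos s.2) ^ 2 = (1 + a) * (1 + b) := by
    linear_combination h2 + h1
  unfold torusWeight jacobiArcsineWeight
  rw [abs_rpow_two_mul_add_one, abs_rpow_two_mul_add_one, e1, e2,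
    Real.mul_rpow (by linarith [ha.2]) (by linarith [hb.2]),
    Real.mul_rpow (by linarith [ha.1]) (by linarith [hb.1])]
  ring

theorem jacobiArcsineWeight_mul_inv_sqrt (α β : ℝ) {t : ℝ} (ht : t ∈ Ioo (-1 : ℝ) 1) :
    jacobiArcsineWeight α β t * √(1 - t ^ 2)⁻¹ = jacobiWeight α β t := by
  have h1 : 0 < 1 - t := by linarith [ht.2]
  have h2 : 0 < 1 + t := by linarith [ht.1]
  have h3 : √(1 - t ^ 2)⁻¹ = ((1 - t) ^ (1 / 2 : ℝ))⁻¹ * ((1 + t) ^ (1 / 2 : ℝ))⁻¹ := by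
    rw [show 1 - t ^ 2 = (1 - t) * (1 + t) by ring, Real.sqrt_inv, Real.sqrt_mul h1.le,
      mul_inv, Real.sqrt_eq_rpow, Real.sqrt_eq_rpow]
  rw [h3, jacobiArcsineWeight, jacobiWeight, Real.rpow_add h1, Real.rpow_add h2]
  have := (Real.rpow_pos_of_pos h1 (1 / 2)).ne'
  have := (Real.rpow_pos_of_pos h2 (1 / 2)).ne'
  field_simp

theorem integral_circle_jacobi (α β : ℝ) (p : ℝ[X]) :
    ∫ t, p.eval (circleCos t) * jacobiArcsineWeight α β (circleCos t) =
      2 * jacobiIntegral α β p := by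
  rw [integral_circleCos (f := fun x => p.eval x * jacobiArcsineWeight α β x)
    (p.continuous.measurable.mul (measurable_jacobiArcsineWeight α β)), jacobiIntegral,
    intervalIntegral.integral_of_le (by norm_num), intervalIntegral.integral_of_le (by norm_num),
    integral_Ioc_eq_integral_Ioo, integral_Ioc_eq_integral_Ioo]
  congr 1
  refine setIntegral_congr_fun measurableSet_Ioo fun t ht => ?_
  simp only [mul_assoc, jacobiArcsineWeight_mul_inv_sqrt α β ht]

theorem integrable_circle_jacobi {α β : ℝ} (hα : -1 < α) (hβ : -1 < β) (p : ℝ[X]) :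
    Integrable fun t => p.eval (circleCos t) * jacobiArcsineWeight α β (circleCos t) := by
  refine integrable_circleCos (f := fun x => p.eval x * jacobiArcsineWeight α β x)
    (p.continuous.measurable.mul (measurable_jacobiArcsineWeight α β)) ?_
  have := intervalIntegrable_eval_mul_jacobiWeight hα hβ p
  rw [intervalIntegrable_iff_integrableOn_Ioo_of_le (by norm_num)] at this ⊢
  refine this.congr_fun (fun t ht => ?_) measurableSet_Ioo
  simp only [mul_assoc, jacobiArcsineWeight_mul_inv_sqrt α β ht]

theorem integrable_torus_product {α β : ℝ} (hα : -1 < α) (hβ : -1 < β) (p q : ℝ[X]) :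
    Integrable fun s : Torus => p.eval (circleCos (torusRotation s).1) *
      q.eval (circleCos (torusRotation s).2) * torusWeight α β s := by
  have h := (integrable_circle_jacobi hα hβ p).mul_prod (integrable_circle_jacobi hα hβ q)
  have := measurePreserving_torusRotation.integrable_comp_of_integrable h
  refine this.congr (Filter.Eventually.of_forall fun s => ?_)
  simp only [Function.comp_def, torusWeight_eq]
  ring

/-- Invariance under the rotation followed by Fubini; each circle contributes a factor 2. -/
theorem integral_torus_product (α β : ℝ) (p q : ℝ[X]) :
    ∫ s : Torus, p.eval (circleCos (torusRotation s).1) *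
      q.eval (circleCos (torusRotation s).2) * torusWeight α β s =
      4 * (jacobiIntegral α β p * jacobiIntegral α β q) := by
  have hm : Measurable fun s : Torus =>
      (p.eval (circleCos s.1) * jacobiArcsineWeight α β (circleCos s.1)) *
      (q.eval (circleCos s.2) * jacobiArcsineWeight α β (circleCos s.2)) := by
    have h1 := measurable_jacobiArcsineWeight α β
    have h2 := continuous_circleCos.measurable
    have h3 := p.continuous.measurable
    have h4 := q.continuous.measurable
    fun_prop
  have h := integral_map (μ := (volume : Measure Torus))
    measurePreserving_torusRotation.measurable.aemeasurable hm.aestronglyMeasurable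
  rw [measurePreserving_torusRotation.map_eq, Measure.volume_eq_prod,
    integral_prod_mul (fun t => p.eval (circleCos t) * jacobiArcsineWeight α β (circleCos t))
      (fun t => q.eval (circleCos t) * jacobiArcsineWeight α β (circleCos t)),
    integral_circle_jacobi, integral_circle_jacobi] at h
  rw [show 4 * (jacobiIntegral α β p * jacobiIntegral α β q) =
    2 * jacobiIntegral α β p * (2 * jacobiIntegral α β q) by ring, h, Measure.volume_eq_prod]
  refine integral_congr_ae (Filter.Eventually.of_forall fun s => ?_)
  simp only [torusWeight_eq]
  ring

theorem integrable_torusWeight {α β : ℝ} (hα : -1 < α) (hβ : -1 < β) :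
    Integrable (torusWeight α β) := by
  simpa using integrable_torus_product hα hβ 1 1

/-- Integrability is automatic for α, β > -1, so only the vanishing of a torus integral remains to
be checked. -/
theorem squareOrthogonal_iff {α β : ℝ} (hα : -1 < α) (hβ : -1 < β)
    (p q : MvPolynomial (Fin 2) ℝ) :
    SquareOrthogonal α β p q ↔
      ∫ s : Torus, MvPolynomial.eval ![circleCos s.1, circleCos s.2] p *
        MvPolynomial.eval ![circleCos s.1, circleCos s.2] q * torusWeight α β s = 0 := by
  have hc : ∀ p : MvPolynomial (Fin 2) ℝ,
      Continuous fun z : ℝ × ℝ => MvPolynomial.eval ![z.1, z.2] p := fun p =>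
    (MvPolynomial.continuous_eval p).comp (by
      refine continuous_pi fun i => ?_
      fin_cases i
      · exact continuous_fst
      · exact continuous_snd)
  have h := integral_square (α := α) (β := β) ((hc p).mul (hc q))
  simp only [Pi.mul_apply] at h
  have hi := integrableOn_square ((hc p).mul (hc q)) (integrable_torusWeight hα hβ)
  simp only [Pi.mul_apply] at hi
  rw [h, SquareOrthogonal, and_iff_right hi]
  simp

theorem integral_torus_swap (f : Torus → ℝ) : ∫ s : Torus, f s.swap = ∫ s, f s := by
  rw [Measure.volume_eq_prod]
  exact integral_prod_swap f

theorem circleCos_add_pi (t : AddCircle (2 * Real.pi)) :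
    circleCos (t + (Real.pi : ℝ)) = -circleCos t := by
  induction t using QuotientAddGroup.induction_on with | _ t => ?_
  exact Real.cos_add_pi t

/-- First of two symmetries that fix a and b: exchanging σ and τ changes the sign of x - y only. -/
theorem torusRotation_swap (s : Torus) : circleCos (torusRotation s.swap).1 =
      circleCos (torusRotation s).1 ∧
    circleCos (torusRotation s.swap).2 = circleCos (torusRotation s).2 := by
  obtain ⟨σ, τ⟩ := s
  induction σ using QuotientAddGroup.induction_on with | _ σ => ?_
  induction τ using QuotientAddGroup.induction_on with | _ τ => ?_
  constructor
  · change Real.cos (τ + σ) = Real.cos (σ + τ)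
    rw [add_comm]
  · change Real.cos (σ - τ) = Real.cos (τ - σ)
    rw [← Real.cos_neg, neg_sub]

/-- Second symmetry: (π, π) lies in the kernel of the rotation, and translating by it changes the
signs of both x and y. -/
theorem torusRotation_add_pi (s : Torus) :
    torusRotation (s + (((Real.pi : ℝ) : AddCircle (2 * Real.pi)),
      ((Real.pi : ℝ) : AddCircle (2 * Real.pi)))) = torusRotation s := by
  have h : ((Real.pi : ℝ) : AddCircle (2 * Real.pi)) + ((Real.pi : ℝ) : AddCircle (2 * Real.pi))
      = 0 := by
    rw [← AddCircle.coe_add, ← two_mul, AddCircle.coe_period]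
  rw [map_add]
  change torusRotation s + (((Real.pi : ℝ) : AddCircle (2 * Real.pi)) + (Real.pi : ℝ),
    ((Real.pi : ℝ) : AddCircle (2 * Real.pi)) - (Real.pi : ℝ)) = _
  rw [h, sub_self]
  exact add_zero _

end ChangeOfVariables

/-! ### Decomposition of polynomials by parity -/

section Decomposition

/-- The span of the functions `(a, b) ↦ p(a) q(b)` with polynomials `p`, `q` of degree less
than `d`. -/
def bidegreeLT (d : ℕ) : Submodule ℝ (ℝ × ℝ → ℝ) :=
  Submodule.span ℝ {f | ∃ p q : ℝ[X], p.degree < d ∧ q.degree < d ∧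
    f = fun z => p.eval z.1 * q.eval z.2}

theorem bidegreeLT_mono {d e : ℕ} (h : d ≤ e) : bidegreeLT d ≤ bidegreeLT e := by
  refine Submodule.span_mono ?_
  rintro _ ⟨p, q, hp, hq, rfl⟩
  exact ⟨p, q, hp.trans_le (by exact_mod_cast h), hq.trans_le (by exact_mod_cast h), rfl⟩

theorem continuous_of_mem_bidegreeLT {d : ℕ} {f : ℝ × ℝ → ℝ} (hf : f ∈ bidegreeLT d) :
    Continuous f := by
  induction hf using Submodule.span_induction with
  | mem x hx =>
    obtain ⟨p, q, -, -, rfl⟩ := hx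
    exact (p.continuous.comp continuous_fst).mul (q.continuous.comp continuous_snd)
  | zero => exact continuous_zero
  | add f g _ _ hf hg => exact hf.add hg
  | smul c f _ hf => exact hf.const_smul c

/-- Applied with r = 1 - X and r = 1 + X, where r(a) r(b) is (x - y)² or (x + y)². -/
theorem mul_mem_bidegreeLT {d : ℕ} {f : ℝ × ℝ → ℝ} (hf : f ∈ bidegreeLT d) {r : ℝ[X]}
    (hr : r.degree ≤ 1) :
    (fun z => r.eval z.1 * r.eval z.2 * f z) ∈ bidegreeLT (d + 1) := by
  have hdeg : ∀ p : ℝ[X], p.degree < d → (r * p).degree < (d + 1 : ℕ) := by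
    intro p hp
    by_cases h0 : p = 0
    · simp only [h0, mul_zero, degree_zero]
      exact WithBot.bot_lt_coe _
    · by_cases hr0 : r = 0
      · simp only [hr0, zero_mul, degree_zero]
        exact WithBot.bot_lt_coe _
      rw [degree_mul, degree_eq_natDegree h0, degree_eq_natDegree hr0] at *
      norm_cast at *
      omega
  induction hf using Submodule.span_induction with
  | mem x hx =>
    obtain ⟨p, q, hp, hq, rfl⟩ := hx
    refine Submodule.subset_span ⟨r * p, r * q, hdeg p hp, hdeg q hq, ?_⟩
    funext z
    simp only [eval_mul]
    ring
  | zero => simp [← Pi.zero_def]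
  | add f g _ _ hf hg =>
    convert Submodule.add_mem _ hf hg using 1
    funext z
    simp only [Pi.add_apply]
    ring
  | smul c f _ hf =>
    convert Submodule.smul_mem _ c hf using 1
    funext z
    simp only [Pi.smul_apply, smul_eq_mul]
    ring

/-- `q` decomposes with respect to the symmetries `(x, y) ↦ (y, x)` and `(x, y) ↦ (-x, -y)`,
with components of the degrees of a polynomial of degree at most `N`. -/
def HasSymmetryDecomposition (N : ℕ) (q : MvPolynomial (Fin 2) ℝ) : Prop :=
  ∃ G : ℕ → ℕ → ℝ × ℝ → ℝ,
    (∀ i < 2, ∀ j < 2, G i j ∈ bidegreeLT ((N + 2 - i - j) / 2)) ∧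
    ∀ x y a b : ℝ, 2 * x * y = a + b → x ^ 2 + y ^ 2 - 1 = a * b →
      MvPolynomial.eval ![x, y] q =
        ∑ i ∈ Finset.range 2, ∑ j ∈ Finset.range 2, (x - y) ^ i * (x + y) ^ j * G i j (a, b)

theorem HasSymmetryDecomposition.mono {N M : ℕ} (h : N ≤ M) {q : MvPolynomial (Fin 2) ℝ}
    (hq : HasSymmetryDecomposition N q) : HasSymmetryDecomposition M q := by
  obtain ⟨G, hG, hq⟩ := hq
  exact ⟨G, fun i hi j hj => bidegreeLT_mono (by omega) (hG i hi j hj), hq⟩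

theorem HasSymmetryDecomposition.add {N : ℕ} {p q : MvPolynomial (Fin 2) ℝ}
    (hp : HasSymmetryDecomposition N p) (hq : HasSymmetryDecomposition N q) :
    HasSymmetryDecomposition N (p + q) := by
  obtain ⟨F, hF, hp⟩ := hp
  obtain ⟨G, hG, hq⟩ := hq
  refine ⟨fun i j => F i j + G i j,
    fun i hi j hj => Submodule.add_mem _ (hF i hi j hj) (hG i hi j hj), fun x y a b h1 h2 => ?_⟩
  rw [map_add, hp x y a b h1 h2, hq x y a b h1 h2]
  simp only [Pi.add_apply, mul_add, Finset.sum_add_distrib]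

theorem HasSymmetryDecomposition.C_mul {N : ℕ} {q : MvPolynomial (Fin 2) ℝ} (c : ℝ)
    (hq : HasSymmetryDecomposition N q) : HasSymmetryDecomposition N (MvPolynomial.C c * q) := by
  obtain ⟨G, hG, hq⟩ := hq
  refine ⟨fun i j => c • G i j, fun i hi j hj => Submodule.smul_mem _ _ (hG i hi j hj),
    fun x y a b h1 h2 => ?_⟩
  rw [map_mul, hq x y a b h1 h2, MvPolynomial.eval_C]
  simp only [Pi.smul_apply, smul_eq_mul, Finset.mul_sum, mul_left_comm]

/-- The bound (N + 2 - i - j) / 2 is ⌊(N - i - j)/2⌋ + 1, and 0 if N < i + j; for N = 0 only the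
component (0, 0) may be nonzero. -/
theorem hasSymmetryDecomposition_one : HasSymmetryDecomposition 0 1 := by
  refine ⟨fun i j => if i = 0 ∧ j = 0 then 1 else 0, fun i hi j hj => ?_,
    fun x y a b _ _ => by simp [Finset.sum_range_succ]⟩
  dsimp only
  split_ifs with h
  · rw [h.1, h.2]
    refine Submodule.subset_span ⟨1, 1, ?_, ?_, ?_⟩
    · simp
    · simp
    · funext z; simp
  · exact Submodule.zero_mem _

/-- Multiplication by x - y moves i = 0 to i = 1, and i = 1 back to i = 0 at the cost of the factor
(1 - a)(1 - b), of degree one in each variable. -/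
theorem HasSymmetryDecomposition.sub_mul {N : ℕ} {q : MvPolynomial (Fin 2) ℝ}
    (hq : HasSymmetryDecomposition N q) :
    HasSymmetryDecomposition (N + 1) ((MvPolynomial.X 0 - MvPolynomial.X 1) * q) := by
  obtain ⟨G, hG, hq⟩ := hq
  refine ⟨fun i j => if i = 0 then fun z => (1 - X : ℝ[X]).eval z.1 * (1 - X : ℝ[X]).eval z.2 *
    G 1 j z else G 0 j, fun i hi j hj => ?_, fun x y a b h1 h2 => ?_⟩
  · have hr : (1 - X : ℝ[X]).degree ≤ 1 := by compute_degree
    dsimp only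
    split_ifs with h
    · exact bidegreeLT_mono (by omega) (mul_mem_bidegreeLT (hG 1 (by omega) j hj) hr)
    · exact bidegreeLT_mono (by omega) (hG 0 (by omega) j hj)
  · rw [map_mul, hq x y a b h1 h2]
    simp only [Finset.sum_range_succ, Finset.sum_range_zero, map_sub, MvPolynomial.eval_X,
      Matrix.cons_val_zero, Matrix.cons_val_one, eval_sub, eval_one, eval_X, reduceIte,
      one_ne_zero, pow_zero, pow_one]
    have e : (x - y) ^ 2 = (1 - a) * (1 - b) := by linear_combination h2 - h1
    simp only [← e]
    ring

theorem HasSymmetryDecomposition.add_mul {N : ℕ} {q : MvPolynomial (Fin 2) ℝ}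
    (hq : HasSymmetryDecomposition N q) :
    HasSymmetryDecomposition (N + 1) ((MvPolynomial.X 0 + MvPolynomial.X 1) * q) := by
  obtain ⟨G, hG, hq⟩ := hq
  refine ⟨fun i j => if j = 0 then fun z => (1 + X : ℝ[X]).eval z.1 * (1 + X : ℝ[X]).eval z.2 *
    G i 1 z else G i 0, fun i hi j hj => ?_, fun x y a b h1 h2 => ?_⟩
  · have hr : (1 + X : ℝ[X]).degree ≤ 1 := by compute_degree
    dsimp only
    split_ifs with h
    · exact bidegreeLT_mono (by omega) (mul_mem_bidegreeLT (hG i hi 1 (by omega)) hr)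
    · exact bidegreeLT_mono (by omega) (hG i hi 0 (by omega))
  · rw [map_mul, hq x y a b h1 h2]
    simp only [Finset.sum_range_succ, Finset.sum_range_zero, map_add, MvPolynomial.eval_X,
      Matrix.cons_val_zero, Matrix.cons_val_one, eval_add, eval_one, eval_X, reduceIte,
      one_ne_zero, pow_zero, pow_one]
    have e : (x + y) ^ 2 = (1 + a) * (1 + b) := by linear_combination h2 + h1
    simp only [← e]
    ring

theorem HasSymmetryDecomposition.X_mul {N : ℕ} {q : MvPolynomial (Fin 2) ℝ}
    (hq : HasSymmetryDecomposition N q) (i : Fin 2) :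
    HasSymmetryDecomposition (N + 1) (MvPolynomial.X i * q) := by
  have hC : (MvPolynomial.C (1 / 2 : ℝ) + MvPolynomial.C (1 / 2 : ℝ) :
      MvPolynomial (Fin 2) ℝ) = 1 := by rw [← MvPolynomial.C_add]; norm_num
  fin_cases i
  · convert (hq.add_mul.C_mul (1 / 2)).add (hq.sub_mul.C_mul (1 / 2)) using 1
    rw [Fin.zero_eta]
    linear_combination (-MvPolynomial.X 0 * q) * hC
  · convert (hq.add_mul.C_mul (1 / 2)).add (hq.sub_mul.C_mul (-(1 / 2))) using 1
    rw [MvPolynomial.C_neg]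
    rw [Fin.mk_one]
    linear_combination (-MvPolynomial.X 1 * q) * hC

theorem hasSymmetryDecomposition_of_totalDegree_le {N : ℕ} {q : MvPolynomial (Fin 2) ℝ}
    (hq : q.totalDegree ≤ N) : HasSymmetryDecomposition N q := by
  have hpow : ∀ i j : ℕ, HasSymmetryDecomposition (i + j)
      (MvPolynomial.X 0 ^ i * MvPolynomial.X 1 ^ j) := by
    intro i j
    induction i with
    | zero =>
      induction j with
      | zero => simpa using hasSymmetryDecomposition_one
      | succ j ih => 
        rw [pow_succ', mul_left_comm]
        exact ih.X_mul 1
    | succ i ih =>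
      rw [pow_succ', mul_assoc, Nat.add_right_comm]
      exact ih.X_mul 0
  have hzero : HasSymmetryDecomposition N 0 := by
    simpa using (hasSymmetryDecomposition_one.mono (Nat.zero_le N)).C_mul 0
  rw [q.as_sum]
  refine Finset.sum_induction _ (HasSymmetryDecomposition N) (fun _ _ h h' => h.add h') hzero ?_
  intro s hs
  rw [MvPolynomial.monomial_eq, Finsupp.prod_fintype _ _ (by simp), Fin.prod_univ_two]
  refine ((hpow (s 0) (s 1)).mono (le_trans ?_ hq)).C_mul _
  have := MvPolynomial.le_totalDegree hs
  rwa [Finsupp.sum_fintype _ _ (by simp), Fin.sum_univ_two] at this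

end Decomposition

/-! ### Orthogonality by parity on the torus -/

section Orthogonality

variable {α β : ℝ}

theorem continuous_torusRotation : Continuous torusRotation := by
  change Continuous fun s : Torus => (s.1 + s.2, s.2 - s.1)
  fun_prop

/-- The coordinates `(cos (σ + τ), cos (τ - σ))` on the torus. -/
def rotatedCos (s : Torus) : ℝ × ℝ :=
  (circleCos (torusRotation s).1, circleCos (torusRotation s).2)

theorem continuous_rotatedCos : Continuous rotatedCos :=
  (continuous_circleCos.comp (continuous_fst.comp continuous_torusRotation)).prodMk
    (continuous_circleCos.comp (continuous_snd.comp continuous_torusRotation))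

theorem integrable_mul_torusWeight (hα : -1 < α) (hβ : -1 < β) {f : Torus → ℝ}
    (hf : Continuous f) : Integrable fun s => f s * torusWeight α β s :=
  integrableOn_univ.1 (IntegrableOn.continuousOn_mul hf.continuousOn
    (integrable_torusWeight hα hβ).integrableOn isCompact_univ)

/-- A measure-preserving symmetry that fixes a, b and the weight reverses the sign of the integrand:
the swap if i is odd, translation by (π, π) if i is even and j odd. -/
theorem integral_odd_torus (F : ℝ × ℝ → ℝ) {i j : ℕ} (h : Odd i ∨ Odd j) :
    ∫ s : Torus, (circleCos s.1 - circleCos s.2) ^ i * (circleCos s.1 + circleCos s.2) ^ j *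
      F (rotatedCos s) * torusWeight α β s = 0 := by
  by_cases hi : Odd i
  · refine self_eq_neg.1 ((integral_torus_swap _).symm.trans ?_)
    rw [← integral_neg]
    refine integral_congr_ae (Filter.Eventually.of_forall fun s => ?_)
    have h1 := torusRotation_swap s
    simp only [rotatedCos, h1, torusWeight, Prod.fst_swap, Prod.snd_swap,
      abs_sub_comm (circleCos s.2), add_comm (circleCos s.2)]
    rw [← neg_sub (circleCos s.1), hi.neg_pow]
    ring
  · have hj : Odd (i + j) := (Nat.not_odd_iff_even.1 hi).add_odd (h.resolve_left hi)
    let c : Torus := (((Real.pi : ℝ) : AddCircle (2 * Real.pi)),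
      ((Real.pi : ℝ) : AddCircle (2 * Real.pi)))
    have hinv : (volume : Measure Torus).IsAddRightInvariant := by
      rw [Measure.volume_eq_prod]; infer_instance
    refine self_eq_neg.1 ((integral_add_right_eq_self _ c).symm.trans ?_)
    rw [← integral_neg]
    refine integral_congr_ae (Filter.Eventually.of_forall fun s => ?_)
    have h1 : torusRotation (s + c) = torusRotation s := torusRotation_add_pi s
    have h2 : circleCos (s + c).1 = -circleCos s.1 := circleCos_add_pi _
    have h3 : circleCos (s + c).2 = -circleCos s.2 := circleCos_add_pi _
    simp only [rotatedCos, torusWeight, h1, h2, h3]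
    generalize circleCos s.1 = x
    generalize circleCos s.2 = y
    have e1 : -x - -y = (-1) * (x - y) := by ring
    have e2 : -x + -y = (-1) * (x + y) := by ring
    rw [e1, e2, mul_pow, mul_pow, abs_mul, abs_mul]
    have e3 : (-1 : ℝ) ^ i * (-1) ^ j = -1 := by rw [← pow_add, hj.neg_one_pow]
    simp only [abs_neg, abs_one, one_mul]
    linear_combination ((x - y) ^ i * (x + y) ^ j *
      F (circleCos (torusRotation s).1, circleCos (torusRotation s).2) *
        (|x - y| ^ (2 * α + 1) * |x + y| ^ (2 * β + 1))) * e3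

theorem sq_mul_abs_rpow (hα : -1 < α) (z : ℝ) :
    z ^ 2 * |z| ^ (2 * α + 1) = |z| ^ (2 * (α + 1) + 1) := by
  rcases eq_or_ne z 0 with rfl | hz
  · rw [abs_zero, Real.zero_rpow (show 2 * (α + 1) + 1 ≠ 0 by linarith)]; simp
  · rw [← sq_abs, ← Real.rpow_natCast, ← Real.rpow_add (abs_pos.2 hz)]
    congr 1; push_cast; ring

/-- Explains the parameters α + 1, β + 1 in the second family: squares of x - y and x + y are
absorbed into the weight. -/
theorem torusWeight_shift (hα : -1 < α) (hβ : -1 < β) {i j : ℕ} (hi : i < 2) (hj : j < 2)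
    (s : Torus) :
    (circleCos s.1 - circleCos s.2) ^ (i + i) * (circleCos s.1 + circleCos s.2) ^ (j + j) *
      torusWeight α β s = torusWeight (α + i) (β + j) s := by
  have h : ∀ (γ z : ℝ), -1 < γ → ∀ i : ℕ, i < 2 → z ^ (i + i) * |z| ^ (2 * γ + 1) =
      |z| ^ (2 * (γ + i) + 1) := by
    intro γ z hγ i hi
    interval_cases i
    · simp
    · simpa using sq_mul_abs_rpow hγ z
  unfold torusWeight
  rw [← h α _ hα i hi, ← h β _ hβ j hj]
  ring

/-- A polynomial of the form `(x - y)^i (x + y)^j H(a, b)` is orthogonal to all polynomials of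
degree at most `N` as soon as `H` is orthogonal to the components of the same parity. -/
theorem integral_parity_mul_eval_eq_zero (hα : -1 < α) (hβ : -1 < β) {i j N : ℕ} (hi : i < 2)
    (hj : j < 2) {H : ℝ × ℝ → ℝ} (hc : Continuous H)
    (hH : ∀ G ∈ bidegreeLT ((N + 2 - i - j) / 2),
      ∫ s : Torus, H (rotatedCos s) * G (rotatedCos s) * torusWeight (α + i) (β + j) s = 0)
    {q : MvPolynomial (Fin 2) ℝ} (hq : q.totalDegree ≤ N) :
    ∫ s : Torus, (circleCos s.1 - circleCos s.2) ^ i * (circleCos s.1 + circleCos s.2) ^ j *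
      H (rotatedCos s) * MvPolynomial.eval ![circleCos s.1, circleCos s.2] q *
        torusWeight α β s = 0 := by
  obtain ⟨G, hG, hq⟩ := hasSymmetryDecomposition_of_totalDegree_le hq
  have key : ∀ s : Torus, (circleCos s.1 - circleCos s.2) ^ i *
      (circleCos s.1 + circleCos s.2) ^ j * H (rotatedCos s) *
      MvPolynomial.eval ![circleCos s.1, circleCos s.2] q * torusWeight α β s =
      ∑ k ∈ Finset.range 2, ∑ l ∈ Finset.range 2,
        (circleCos s.1 - circleCos s.2) ^ (i + k) * (circleCos s.1 + circleCos s.2) ^ (j + l) *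
          (H * G k l) (rotatedCos s) * torusWeight α β s := by
    intro s
    rw [hq _ _ _ _ (circleCos_mul_circleCos s) (circleCos_sq_add_sq s)]
    simp only [Finset.mul_sum, Finset.sum_mul]
    refine Finset.sum_congr rfl fun k _ => Finset.sum_congr rfl fun l _ => ?_
    simp only [Pi.mul_apply, rotatedCos]
    ring
  have hint : ∀ k ∈ Finset.range 2, ∀ l ∈ Finset.range 2, Integrable fun s : Torus =>
      (circleCos s.1 - circleCos s.2) ^ (i + k) * (circleCos s.1 + circleCos s.2) ^ (j + l) *
          (H * G k l) (rotatedCos s) * torusWeight α β s := by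
    intro k hk l hl
    refine integrable_mul_torusWeight hα hβ ?_
    have h1 := (hc.mul (continuous_of_mem_bidegreeLT
      (hG k (Finset.mem_range.1 hk) l (Finset.mem_range.1 hl)))).comp continuous_rotatedCos
    have h2 := continuous_circleCos
    exact (((h2.comp continuous_fst).sub (h2.comp continuous_snd)).pow _ |>.mul
      (((h2.comp continuous_fst).add (h2.comp continuous_snd)).pow _)).mul h1
  simp_rw [key]
  rw [integral_finsetSum _ fun k hk => integrable_finsetSum _ (hint k hk)]
  refine Finset.sum_eq_zero fun k hk => ?_
  rw [integral_finsetSum _ (hint k hk)]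
  refine Finset.sum_eq_zero fun l hl => ?_
  rw [Finset.mem_range] at hk hl
  -- Equal parity leaves a shifted weight; any other pair has an odd exponent and integrates to
  -- zero.
  by_cases hkl : k = i ∧ l = j
  · obtain ⟨rfl, rfl⟩ := hkl
    rw [← hH (G k l) (hG k hk l hl)]
    refine integral_congr_ae (Filter.Eventually.of_forall fun s => ?_)
    simp only [← torusWeight_shift hα hβ hk hl s, Pi.mul_apply]
    ring
  · refine integral_odd_torus _ ?_
    rw [Nat.odd_iff, Nat.odd_iff]
    omega

end Orthogonality

/-! ### Degree bounds via elementary symmetric polynomials -/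

section Degree

/-- `s` is a polynomial of degree at most `d` in the elementary symmetric polynomials. -/
def IsElementaryOfDegreeLE (d : ℕ) (s : MvPolynomial (Fin 2) ℝ) : Prop :=
  ∃ g : MvPolynomial (Fin 2) ℝ, g.totalDegree ≤ d ∧ MvPolynomial.aeval
    ![(MvPolynomial.X 0 + MvPolynomial.X 1 : MvPolynomial (Fin 2) ℝ),
      MvPolynomial.X 0 * MvPolynomial.X 1] g = s

theorem IsElementaryOfDegreeLE.add {d : ℕ} {s t : MvPolynomial (Fin 2) ℝ}
    (hs : IsElementaryOfDegreeLE d s) (ht : IsElementaryOfDegreeLE d t) :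
    IsElementaryOfDegreeLE d (s + t) := by
  obtain ⟨g, hg, rfl⟩ := hs
  obtain ⟨h, hh, rfl⟩ := ht
  exact ⟨g + h, (MvPolynomial.totalDegree_add _ _).trans (max_le hg hh), map_add _ _ _⟩

theorem IsElementaryOfDegreeLE.mul {d e : ℕ} {s t : MvPolynomial (Fin 2) ℝ}
    (hs : IsElementaryOfDegreeLE d s) (ht : IsElementaryOfDegreeLE e t) :
    IsElementaryOfDegreeLE (d + e) (s * t) := by
  obtain ⟨g, hg, rfl⟩ := hs
  obtain ⟨h, hh, rfl⟩ := ht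
  exact ⟨g * h, (MvPolynomial.totalDegree_mul _ _).trans (add_le_add hg hh), map_mul _ _ _⟩

theorem isElementaryOfDegreeLE_C (c : ℝ) : IsElementaryOfDegreeLE 0 (MvPolynomial.C c) :=
  ⟨MvPolynomial.C c, by simp, MvPolynomial.aeval_C _ _⟩

theorem IsElementaryOfDegreeLE.smul {d : ℕ} {s : MvPolynomial (Fin 2) ℝ} (c : ℝ)
    (hs : IsElementaryOfDegreeLE d s) : IsElementaryOfDegreeLE d (c • s) := by
  rw [MvPolynomial.smul_eq_C_mul]
  simpa using (isElementaryOfDegreeLE_C c).mul hs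

theorem IsElementaryOfDegreeLE.mono {d e : ℕ} (h : d ≤ e) {s : MvPolynomial (Fin 2) ℝ}
    (hs : IsElementaryOfDegreeLE d s) : IsElementaryOfDegreeLE e s := by
  obtain ⟨g, hg, hs⟩ := hs
  exact ⟨g, hg.trans h, hs⟩

theorem isElementaryOfDegreeLE_add :
    IsElementaryOfDegreeLE 1 (MvPolynomial.X 0 + MvPolynomial.X 1) :=
  ⟨MvPolynomial.X 0, by simp, by simp⟩

theorem isElementaryOfDegreeLE_mul :
    IsElementaryOfDegreeLE 1 (MvPolynomial.X 0 * MvPolynomial.X 1) :=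
  ⟨MvPolynomial.X 1, by simp, by simp⟩

/-- Newton's recursion s_{r+2} = e₁ s_{r+1} - e₂ s_r. -/
theorem isElementaryOfDegreeLE_powerSum (r : ℕ) :
    IsElementaryOfDegreeLE r (MvPolynomial.X 0 ^ r + MvPolynomial.X 1 ^ r) := by
  induction r using Nat.twoStepInduction with
  | zero => simpa using (isElementaryOfDegreeLE_C 1).add (isElementaryOfDegreeLE_C 1)
  | one => simpa using isElementaryOfDegreeLE_add
  | more r h0 h1 =>
    have h := ((isElementaryOfDegreeLE_add.mul h1).mono (e := r + 2) (by omega)).add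
      (((isElementaryOfDegreeLE_mul.mul h0).smul (-1)).mono (e := r + 2) (by omega))
    convert h using 1
    rw [neg_one_smul]
    ring

theorem isElementaryOfDegreeLE_mul_pow (r : ℕ) :
    IsElementaryOfDegreeLE r ((MvPolynomial.X 0 * MvPolynomial.X 1) ^ r) := by
  induction r with
  | zero => simpa using isElementaryOfDegreeLE_C 1
  | succ r ih => rw [pow_succ]; exact ih.mul isElementaryOfDegreeLE_mul

/-- Factor out e₂^{min(i,j)}; a power sum of index |i - j| remains. The degree is thus max(i, j) and
not i + j, which is why P_{k,n} has degree at most n. -/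
theorem isElementaryOfDegreeLE_monomial {i j d : ℕ} (hi : i ≤ d) (hj : j ≤ d) :
    IsElementaryOfDegreeLE d (MvPolynomial.X 0 ^ i * MvPolynomial.X 1 ^ j +
      MvPolynomial.X 1 ^ i * MvPolynomial.X 0 ^ j) := by
  have key : ∀ i r : ℕ, i + r ≤ d →
      IsElementaryOfDegreeLE d (MvPolynomial.X 0 ^ i * MvPolynomial.X 1 ^ (i + r) +
        MvPolynomial.X 1 ^ i * MvPolynomial.X 0 ^ (i + r)) := by
    intro i r h
    convert ((isElementaryOfDegreeLE_mul_pow i).mul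
      (isElementaryOfDegreeLE_powerSum r)).mono h using 1
    ring
  rcases le_total i j with h | h
  · obtain ⟨r, rfl⟩ := Nat.exists_eq_add_of_le h
    exact key i r hj
  · obtain ⟨r, rfl⟩ := Nat.exists_eq_add_of_le h
    convert key j r hi using 1
    ring

theorem isElementaryOfDegreeLE_symmetrization {p q : ℝ[X]} {d : ℕ} (hp : p.natDegree ≤ d)
    (hq : q.natDegree ≤ d) :
    IsElementaryOfDegreeLE d
      (aeval (MvPolynomial.X 0) p * aeval (MvPolynomial.X 1) q +
        aeval (MvPolynomial.X 1) p * aeval (MvPolynomial.X 0) q) := by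
  have h0 : IsElementaryOfDegreeLE d 0 := by
    simpa using (isElementaryOfDegreeLE_C 0).mono (Nat.zero_le d)
  simp only [aeval_eq_sum_range' (Nat.lt_succ_of_le hp), aeval_eq_sum_range' (Nat.lt_succ_of_le hq),
    Finset.sum_mul_sum, ← Finset.sum_add_distrib]
  refine Finset.sum_induction _ _ (fun _ _ h h' => h.add h') h0 fun i hi => ?_
  refine Finset.sum_induction _ _ (fun _ _ h h' => h.add h') h0 fun j hj => ?_
  rw [Finset.mem_range] at hi hj
  convert (isElementaryOfDegreeLE_monomial (Nat.le_of_lt_succ hi) (Nat.le_of_lt_succ hj)).smul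
    (p.coeff i * q.coeff j) using 1
  rw [smul_mul_smul_comm, smul_mul_smul_comm, smul_add]

theorem natDegree_jacobiP {α β : ℝ} (hα : -1 < α) (hβ : -1 < β) (n : ℕ) :
    (jacobiP α β n).natDegree = n := natDegree_eq_of_degree_eq_some (degree_jacobiP hα hβ n)

theorem isElementaryOfDegreeLE_koornwinderSym {α β : ℝ} (hα : -1 < α) (hβ : -1 < β) {k n : ℕ}
    (hk : k ≤ n) : IsElementaryOfDegreeLE n (koornwinderSym α β k n) := by
  have h := isElementaryOfDegreeLE_symmetrization (natDegree_jacobiP hα hβ n).le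
    ((natDegree_jacobiP hα hβ k).le.trans hk)
  unfold koornwinderSym
  split_ifs with hkn
  · subst hkn
    -- For k = n the symmetrization is 2 p_n(x) p_n(y), so half of √2 gives the required
    -- normalization.
    convert h.smul (√2 / 2) using 1
    rw [← mul_comm (aeval (MvPolynomial.X 0) (jacobiP α β k)), ← two_smul ℝ, smul_smul,
      div_mul_cancel₀ _ two_ne_zero, MvPolynomial.smul_eq_C_mul]
  · exact h

/-- The representation in elementary symmetric polynomials is unique, so it is the low-degree one
already found. -/
theorem totalDegree_koornwinder_le {α β : ℝ} (hα : -1 < α) (hβ : -1 < β) {k n : ℕ}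
    (hk : k ≤ n) : (koornwinder α β k n).totalDegree ≤ n := by
  obtain ⟨g, hg, h⟩ := isElementaryOfDegreeLE_koornwinderSym hα hβ hk
  suffices koornwinder α β k n = g by rwa [this]
  unfold koornwinder
  rw [AlgEquiv.symm_apply_eq]
  refine Subtype.ext ?_
  rw [MvPolynomial.esymmAlgEquiv_apply, MvPolynomial.esymmAlgHom_apply]
  refine h.symm.trans ?_
  congr 2
  funext i
  fin_cases i
  · simp [MvPolynomial.esymm_one, Fin.sum_univ_two]
  · have : Finset.powersetCard 2 (Finset.univ : Finset (Fin 2)) = {Finset.univ} := by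
      decide
    simp [MvPolynomial.esymm, this, Fin.prod_univ_two]

theorem totalDegree_parabolicSubst_le (p : MvPolynomial (Fin 2) ℝ) :
    (parabolicSubst p).totalDegree ≤ 2 * p.totalDegree := by
  have h2 : (2 : MvPolynomial (Fin 2) ℝ).totalDegree = 0 := MvPolynomial.totalDegree_C (2 : ℝ)
  have hu : (2 * MvPolynomial.X 0 * MvPolynomial.X 1 : MvPolynomial (Fin 2) ℝ).totalDegree ≤ 2 := by
    refine (MvPolynomial.totalDegree_mul _ _).trans ?_
    have := MvPolynomial.totalDegree_mul (2 : MvPolynomial (Fin 2) ℝ) (MvPolynomial.X 0)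
    rw [h2, MvPolynomial.totalDegree_X] at this
    rw [MvPolynomial.totalDegree_X]
    omega
  have hv : (MvPolynomial.X 0 ^ 2 + MvPolynomial.X 1 ^ 2 - 1 :
      MvPolynomial (Fin 2) ℝ).totalDegree ≤ 2 := by
    refine (MvPolynomial.totalDegree_sub _ _).trans (max_le
      ((MvPolynomial.totalDegree_add _ _).trans (max_le ?_ ?_)) ?_)
    · exact MvPolynomial.totalDegree_X_pow 0 2 |>.le
    · exact MvPolynomial.totalDegree_X_pow 1 2 |>.le
    · simp
  unfold parabolicSubst
  conv_lhs => rw [p.as_sum, map_sum]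
  refine MvPolynomial.totalDegree_finsetSum_le fun s hs => ?_
  rw [MvPolynomial.aeval_monomial, Finsupp.prod_fintype _ _ (by simp), Fin.prod_univ_two,
    MvPolynomial.algebraMap_eq]
  have hd := MvPolynomial.le_totalDegree hs
  rw [Finsupp.sum_fintype _ _ (by simp), Fin.sum_univ_two] at hd
  refine (MvPolynomial.totalDegree_mul _ _).trans ?_
  rw [MvPolynomial.totalDegree_C, zero_add]
  refine (MvPolynomial.totalDegree_mul _ _).trans ?_
  have h0 := (MvPolynomial.totalDegree_pow
    (2 * MvPolynomial.X 0 * MvPolynomial.X 1 : MvPolynomial (Fin 2) ℝ) (s 0)).trans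
    (Nat.mul_le_mul_left _ hu)
  have h1 := (MvPolynomial.totalDegree_pow
    (MvPolynomial.X 0 ^ 2 + MvPolynomial.X 1 ^ 2 - 1 : MvPolynomial (Fin 2) ℝ) (s 1)).trans
    (Nat.mul_le_mul_left _ hv)
  simp only [Matrix.cons_val_zero, Matrix.cons_val_one]
  omega

variable {α β : ℝ}

theorem totalDegree_evenQ₁_le (hα : -1 < α) (hβ : -1 < β) {k n : ℕ} (hk : k ≤ n) :
    (evenQ₁ α β k n).totalDegree ≤ 2 * n :=
  (totalDegree_parabolicSubst_le _).trans
    (Nat.mul_le_mul_left _ (totalDegree_koornwinder_le hα hβ hk))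

theorem totalDegree_evenQ₂_le (hα : -1 < α) (hβ : -1 < β) {k n : ℕ} (hk : k ≤ n) :
    (evenQ₂ α β k (n + 1)).totalDegree ≤ 2 * (n + 1) := by
  have h := (totalDegree_parabolicSubst_le (koornwinder (α + 1) (β + 1) k n)).trans
    (Nat.mul_le_mul_left _ (totalDegree_koornwinder_le (by linarith) (by linarith) hk))
  have h2 : (MvPolynomial.X 0 ^ 2 - MvPolynomial.X 1 ^ 2 :
      MvPolynomial (Fin 2) ℝ).totalDegree ≤ 2 :=
    (MvPolynomial.totalDegree_sub _ _).trans (max_le (MvPolynomial.totalDegree_X_pow 0 2).le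
      (MvPolynomial.totalDegree_X_pow 1 2).le)
  unfold evenQ₂
  refine (MvPolynomial.totalDegree_mul _ _).trans ?_
  have h3 := MvPolynomial.totalDegree_mul
    (MvPolynomial.C ((α + β + 2) * (α + β + 3) / (4 * (α + 1) * (β + 1))))
    (MvPolynomial.X 0 ^ 2 - MvPolynomial.X 1 ^ 2 : MvPolynomial (Fin 2) ℝ)
  rw [MvPolynomial.totalDegree_C] at h3
  rw [Nat.add_sub_cancel]
  omega

theorem totalDegree_oddQ₂_le (hα : -1 < α) (hβ : -1 < β) {k n : ℕ} (hk : k ≤ n) :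
    (oddQ₂ α β k n).totalDegree ≤ 2 * n + 1 := by
  have h := (totalDegree_parabolicSubst_le (koornwinder (α + 1) β k n)).trans
    (Nat.mul_le_mul_left _ (totalDegree_koornwinder_le (by linarith) hβ hk))
  have h2 : (MvPolynomial.X 0 - MvPolynomial.X 1 : MvPolynomial (Fin 2) ℝ).totalDegree ≤ 1 :=
    (MvPolynomial.totalDegree_sub _ _).trans (max_le (MvPolynomial.totalDegree_X 0).le
      (MvPolynomial.totalDegree_X 1).le)
  unfold oddQ₂
  refine (MvPolynomial.totalDegree_mul _ _).trans ?_
  have h3 := MvPolynomial.totalDegree_mul (MvPolynomial.C ((α + β + 2) / (2 * (α + 1))))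
    (MvPolynomial.X 0 - MvPolynomial.X 1 : MvPolynomial (Fin 2) ℝ)
  rw [MvPolynomial.totalDegree_C] at h3
  omega

end Degree

/-! ### Evaluation in the variables a, b -/

section Evaluation

variable {K : Type*} [CommRing K] [Algebra ℝ K] (α β : ℝ)

theorem aeval_aeval_X (a b : K) (p : ℝ[X]) :
    MvPolynomial.aeval ![a, b] (aeval (MvPolynomial.X 0 : MvPolynomial (Fin 2) ℝ) p) = aeval a p ∧
      MvPolynomial.aeval ![a, b] (aeval (MvPolynomial.X 1 : MvPolynomial (Fin 2) ℝ) p) =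
        aeval b p := by
  constructor <;> rw [← Polynomial.aeval_algHom_apply, MvPolynomial.aeval_X] <;> rfl

theorem aeval_koornwinderSym (k n : ℕ) (a b : K) :
    MvPolynomial.aeval ![a, b] (koornwinderSym α β k n) =
      if k = n then algebraMap ℝ K √2 * (aeval a (jacobiP α β n) * aeval b (jacobiP α β n))
      else aeval a (jacobiP α β n) * aeval b (jacobiP α β k) +
        aeval b (jacobiP α β n) * aeval a (jacobiP α β k) := by
  unfold koornwinderSym
  split_ifs
  · simp only [map_mul, aeval_aeval_X, MvPolynomial.aeval_C]
  · simp only [map_mul, map_add, aeval_aeval_X]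

/-- Stated over an arbitrary algebra because it serves both the real torus integrals and the complex
variety. -/
theorem aeval_parabolicSubst_koornwinder (k n : ℕ) {x y a b : K} (h1 : 2 * x * y = a + b)
    (h2 : x ^ 2 + y ^ 2 - 1 = a * b) :
    MvPolynomial.aeval ![x, y] (parabolicSubst (koornwinder α β k n)) =
      MvPolynomial.aeval ![a, b] (koornwinderSym α β k n) := by
  unfold parabolicSubst
  rw [← aeval_koornwinder, ← AlgHom.comp_apply, ← AlgHom.comp_apply, MvPolynomial.comp_aeval,
    MvPolynomial.comp_aeval]
  congr 2
  funext i
  fin_cases i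
  · simpa using h1
  · simpa using h2

end Evaluation

/-! ### Orthogonality of the polynomials Q and quasi-orthogonality of the generators -/

section Orthogonality

variable {α β : ℝ}

theorem SquareOrthogonal.symm {p q : MvPolynomial (Fin 2) ℝ} (h : SquareOrthogonal α β p q) :
    SquareOrthogonal α β q p := by
  unfold SquareOrthogonal at *
  simpa only [mul_comm (MvPolynomial.eval _ q)] using h

theorem SquareOrthogonal.add {p p' q : MvPolynomial (Fin 2) ℝ} (h : SquareOrthogonal α β p q)
    (h' : SquareOrthogonal α β p' q) : SquareOrthogonal α β (p + p') q := by
  unfold SquareOrthogonal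
  simp only [map_add, add_mul]
  refine ⟨h.1.add h'.1, ?_⟩
  rw [integral_add h.1 h'.1, h.2, h'.2, add_zero]

theorem SquareOrthogonal.C_mul (c : ℝ) {p q : MvPolynomial (Fin 2) ℝ}
    (h : SquareOrthogonal α β p q) : SquareOrthogonal α β (MvPolynomial.C c * p) q := by
  unfold SquareOrthogonal
  simp only [map_mul, MvPolynomial.eval_C, mul_assoc]
  simp only [← mul_assoc (MvPolynomial.eval _ p)]
  refine ⟨h.1.const_mul c, ?_⟩
  rw [integral_const_mul, h.2, mul_zero]

theorem squareOrthogonal_zero (q : MvPolynomial (Fin 2) ℝ) : SquareOrthogonal α β 0 q := by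
  simp [SquareOrthogonal]

theorem SquareOrthogonal.sum {ι : Type*} (s : Finset ι) {f : ι → MvPolynomial (Fin 2) ℝ}
    {q : MvPolynomial (Fin 2) ℝ} (h : ∀ i ∈ s, SquareOrthogonal α β (f i) q) :
    SquareOrthogonal α β (∑ i ∈ s, f i) q :=
  Finset.sum_induction f (SquareOrthogonal α β · q) (fun _ _ => SquareOrthogonal.add)
    (squareOrthogonal_zero q) h

theorem eval_koornwinderSym (α β : ℝ) (k n : ℕ) (z : ℝ × ℝ) :
    MvPolynomial.eval ![z.1, z.2] (koornwinderSym α β k n) =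
      if k = n then √2 * ((jacobiP α β n).eval z.1 * (jacobiP α β n).eval z.2)
      else (jacobiP α β n).eval z.1 * (jacobiP α β k).eval z.2 +
        (jacobiP α β n).eval z.2 * (jacobiP α β k).eval z.1 := by
  simpa [MvPolynomial.aeval_eq_eval, coe_aeval_eq_eval] using aeval_koornwinderSym α β k n z.1 z.2

theorem continuous_eval_koornwinderSym (α β : ℝ) (k n : ℕ) :
    Continuous fun z : ℝ × ℝ => MvPolynomial.eval ![z.1, z.2] (koornwinderSym α β k n) := by
  simp only [eval_koornwinderSym]
  split_ifs <;> fun_prop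

/-- Each term contains p_n in one of the two variables, and that one-variable factor integrates to
zero against degree below n. -/
theorem integral_koornwinderSym_mul (hα : -1 < α) (hβ : -1 < β) (k : ℕ) {n d : ℕ} (hd : d ≤ n)
    {G : ℝ × ℝ → ℝ} (hG : G ∈ bidegreeLT d) :
    ∫ s : Torus, MvPolynomial.eval ![(rotatedCos s).1, (rotatedCos s).2] (koornwinderSym α β k n) *
      G (rotatedCos s) * torusWeight α β s = 0 := by
  have hint : ∀ G : ℝ × ℝ → ℝ, G ∈ bidegreeLT d → Integrable fun s : Torus =>
      MvPolynomial.eval ![(rotatedCos s).1, (rotatedCos s).2] (koornwinderSym α β k n) *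
        G (rotatedCos s) * torusWeight α β s := fun G hG =>
    integrable_mul_torusWeight hα hβ (((continuous_eval_koornwinderSym α β k n).mul
      (continuous_of_mem_bidegreeLT hG)).comp continuous_rotatedCos)
  induction hG using Submodule.span_induction with
  | mem G hG =>
    obtain ⟨p, q, hp, hq, rfl⟩ := hG
    have hp0 := jacobiIntegral_jacobiP_mul hα hβ (hp.trans_le (by exact_mod_cast hd))
    have hq0 := jacobiIntegral_jacobiP_mul hα hβ (hq.trans_le (by exact_mod_cast hd))
    simp only [eval_koornwinderSym]
    split_ifs
    · have h := integral_torus_product α β (jacobiP α β n * p) (jacobiP α β n * q)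
      rw [hp0, zero_mul, mul_zero] at h
      rw [← mul_zero √2, ← h, ← integral_const_mul]
      refine integral_congr_ae (Filter.Eventually.of_forall fun s => ?_)
      simp only [eval_mul, rotatedCos]
      ring
    · have h := integral_torus_product α β (jacobiP α β n * p) (jacobiP α β k * q)
      have h' := integral_torus_product α β (jacobiP α β k * p) (jacobiP α β n * q)
      rw [hp0, zero_mul, mul_zero] at h
      rw [hq0, mul_zero, mul_zero] at h'
      have h'' := congrArg₂ (· + ·) h h'
      rw [← integral_add (integrable_torus_product hα hβ _ _)
        (integrable_torus_product hα hβ _ _), add_zero] at h''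
      rw [← h'']
      refine integral_congr_ae (Filter.Eventually.of_forall fun s => ?_)
      simp only [eval_mul, rotatedCos]
      ring
  | zero => simp
  | add F G hF hG hF' hG' =>
    have h := integral_add (hint F hF) (hint G hG)
    rw [hF', hG', add_zero] at h
    rw [← h]
    refine integral_congr_ae (Filter.Eventually.of_forall fun s => ?_)
    simp only [Pi.add_apply]
    ring
  | smul c G hG hG' =>
    rw [← mul_zero c, ← hG', ← integral_const_mul]
    refine integral_congr_ae (Filter.Eventually.of_forall fun s => ?_)
    simp only [Pi.smul_apply, smul_eq_mul]
    ring

/-- For k ≠ n, expanding the square gives 8 (∫p² ∫q² + (∫pq)²), positive whatever the cross term. -/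
theorem integral_koornwinderSym_sq_pos (hα : -1 < α) (hβ : -1 < β) (k n : ℕ) :
    0 < ∫ s : Torus, MvPolynomial.eval ![(rotatedCos s).1, (rotatedCos s).2]
      (koornwinderSym α β k n) ^ 2 * torusWeight α β s := by
  set p := jacobiP α β n
  set q := jacobiP α β k
  have hp : 0 < jacobiIntegral α β (p * p) :=
    jacobiIntegral_mul_self_pos hα hβ (jacobiP_ne_zero hα hβ n)
  have hq : 0 < jacobiIntegral α β (q * q) :=
    jacobiIntegral_mul_self_pos hα hβ (jacobiP_ne_zero hα hβ k)
  simp only [eval_koornwinderSym]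
  split_ifs
  · have h := integral_torus_product α β (p * p) (p * p)
    have : ∫ s : Torus, (√2 * (p.eval (rotatedCos s).1 * p.eval (rotatedCos s).2)) ^ 2 *
        torusWeight α β s = 2 * (4 * (jacobiIntegral α β (p * p) * jacobiIntegral α β (p * p))) := by
      rw [← h, ← integral_const_mul]
      refine integral_congr_ae (Filter.Eventually.of_forall fun s => ?_)
      simp only [eval_mul, rotatedCos, mul_pow, Real.sq_sqrt (show (0 : ℝ) ≤ 2 by norm_num)]
      ring
    rw [this]
    positivity
  · have h1 := integral_torus_product α β (p * p) (q * q)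
    have h2 := integral_torus_product α β (q * q) (p * p)
    have h3 := integral_torus_product α β (p * q) (p * q)
    have i1 := integrable_torus_product hα hβ (p * p) (q * q)
    have i2 := integrable_torus_product hα hβ (q * q) (p * p)
    have i3 := (integrable_torus_product hα hβ (p * q) (p * q)).const_mul 2
    have h := integral_add (i1.add i2) i3
    rw [integral_add' i1 i2, integral_const_mul, h1, h2, h3] at h
    refine lt_of_lt_of_eq ?_ (h.symm.trans (integral_congr_ae (Filter.Eventually.of_forall
      fun s => ?_)))
    · nlinarith [mul_pos hp hq, mul_self_nonneg (jacobiIntegral α β (p * q))]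
    · simp only [eval_mul, rotatedCos, Pi.add_apply]
      ring

theorem eval_parabolicSubst_koornwinder (α β : ℝ) (k n : ℕ) (s : Torus) :
    MvPolynomial.eval ![circleCos s.1, circleCos s.2] (parabolicSubst (koornwinder α β k n)) =
      MvPolynomial.eval ![(rotatedCos s).1, (rotatedCos s).2] (koornwinderSym α β k n) := by
  simpa [MvPolynomial.aeval_eq_eval, rotatedCos] using aeval_parabolicSubst_koornwinder α β k n
    (circleCos_mul_circleCos s) (circleCos_sq_add_sq s)

/-- The polynomials `c (x - y)^i (x + y)^j P_{k,n}^{α+i,β+j}` are orthogonal to all polynomials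
of lower degree. -/
theorem squareOrthogonal_parity (hα : -1 < α) (hβ : -1 < β) {i j : ℕ} (hi : i < 2) (hj : j < 2)
    (k n : ℕ) (c : ℝ) {p q : MvPolynomial (Fin 2) ℝ}
    (hp : p = MvPolynomial.C c * ((MvPolynomial.X 0 - MvPolynomial.X 1) ^ i *
      (MvPolynomial.X 0 + MvPolynomial.X 1) ^ j *
        parabolicSubst (koornwinder (α + i) (β + j) k n)))
    (hq : q.totalDegree < 2 * n + i + j) :
    SquareOrthogonal α β p q := by
  subst hp
  refine SquareOrthogonal.C_mul c ((squareOrthogonal_iff hα hβ _ _).2 ?_)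
  have hα' : -1 < α + i := by linarith [Nat.cast_nonneg (α := ℝ) i]
  have hβ' : -1 < β + j := by linarith [Nat.cast_nonneg (α := ℝ) j]
  have h := integral_parity_mul_eval_eq_zero hα hβ hi hj
    (continuous_eval_koornwinderSym (α + i) (β + j) k n)
    (fun G hG => integral_koornwinderSym_mul hα' hβ' k
      (show (q.totalDegree + 2 - i - j) / 2 ≤ n by omega) hG) le_rfl
  simpa only [map_mul, map_pow, map_sub, map_add, MvPolynomial.eval_X, Matrix.cons_val_zero,
    Matrix.cons_val_one, eval_parabolicSubst_koornwinder] using h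

theorem not_squareOrthogonal_self_parity (hα : -1 < α) (hβ : -1 < β) {i j : ℕ} (hi : i < 2)
    (hj : j < 2) (k n : ℕ) {c : ℝ} (hc : c ≠ 0) {p : MvPolynomial (Fin 2) ℝ}
    (hp : p = MvPolynomial.C c * ((MvPolynomial.X 0 - MvPolynomial.X 1) ^ i *
      (MvPolynomial.X 0 + MvPolynomial.X 1) ^ j *
        parabolicSubst (koornwinder (α + i) (β + j) k n))) :
    ¬ SquareOrthogonal α β p p := by
  rw [squareOrthogonal_iff hα hβ]
  have hα' : -1 < α + i := by linarith [Nat.cast_nonneg (α := ℝ) i]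
  have hβ' : -1 < β + j := by linarith [Nat.cast_nonneg (α := ℝ) j]
  have h := mul_pos (sq_pos_of_ne_zero hc) (integral_koornwinderSym_sq_pos hα' hβ' k n)
  rw [← integral_const_mul] at h
  refine fun h0 => h.ne' (Eq.trans (integral_congr_ae (Filter.Eventually.of_forall fun s => ?_)) h0)
  simp only [hp, map_mul, map_pow, map_sub, map_add, MvPolynomial.eval_X, Matrix.cons_val_zero,
    Matrix.cons_val_one, eval_parabolicSubst_koornwinder, MvPolynomial.eval_C,
    ← torusWeight_shift hα hβ hi hj s]
  ring

/-- The three families are the cases (i, j) = (0, 0), (1, 1), (1, 0) of one form, to which the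
parity lemmas apply. -/
theorem evenQ₁_eq (α β : ℝ) (k n : ℕ) :
    evenQ₁ α β k n = MvPolynomial.C 1 * ((MvPolynomial.X 0 - MvPolynomial.X 1) ^ 0 *
      (MvPolynomial.X 0 + MvPolynomial.X 1) ^ 0 *
        parabolicSubst (koornwinder (α + (0 : ℕ)) (β + (0 : ℕ)) k n)) := by
  simp [evenQ₁]

theorem evenQ₂_eq (α β : ℝ) (k n : ℕ) :
    evenQ₂ α β k (n + 1) =
      MvPolynomial.C ((α + β + 2) * (α + β + 3) / (4 * (α + 1) * (β + 1))) *
      ((MvPolynomial.X 0 - MvPolynomial.X 1) ^ 1 * (MvPolynomial.X 0 + MvPolynomial.X 1) ^ 1 *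
        parabolicSubst (koornwinder (α + (1 : ℕ)) (β + (1 : ℕ)) k n)) := by
  simp only [evenQ₂, Nat.cast_one, Nat.add_sub_cancel]
  ring

theorem oddQ₂_eq (α β : ℝ) (k n : ℕ) :
    oddQ₂ α β k n = MvPolynomial.C ((α + β + 2) / (2 * (α + 1))) *
      ((MvPolynomial.X 0 - MvPolynomial.X 1) ^ 1 * (MvPolynomial.X 0 + MvPolynomial.X 1) ^ 0 *
        parabolicSubst (koornwinder (α + (1 : ℕ)) (β + (0 : ℕ)) k n)) := by
  simp only [oddQ₂, Nat.cast_one, Nat.cast_zero, add_zero]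
  ring

theorem isOrthogonalPoly_oddQ₂ (hα : -1 < α) (hβ : -1 < β) {k n : ℕ} (hk : k ≤ n) :
    IsOrthogonalPoly α β (2 * n + 1) (oddQ₂ α β k n) :=
  ⟨totalDegree_oddQ₂_le hα hβ hk, fun _ hq => squareOrthogonal_parity hα hβ (by norm_num)
    (by norm_num) k n _ (oddQ₂_eq α β k n) (by omega)⟩

theorem isOrthogonalPoly_vecQ (hα : -1 < α) (hβ : -1 < β) (n : ℕ) (i : Fin (n + 1) ⊕ Fin n) :
    IsOrthogonalPoly α β (2 * n) (vecQ α β n i) := by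
  rcases i with k | k
  · exact ⟨totalDegree_evenQ₁_le hα hβ (by omega), fun _ hq => squareOrthogonal_parity hα hβ
      (by norm_num) (by norm_num) k n _ (evenQ₁_eq α β k n) (by omega)⟩
  · obtain _ | n := n
    · exact k.elim0
    · exact ⟨totalDegree_evenQ₂_le hα hβ (by omega), fun _ hq => squareOrthogonal_parity hα hβ
        (by norm_num) (by norm_num) k n _ (evenQ₂_eq α β k n) (by omega)⟩

theorem evenQ₂_constant_pos (hα : -1 < α) (hβ : -1 < β) :
    0 < (α + β + 2) * (α + β + 3) / (4 * (α + 1) * (β + 1)) := by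
  have : 0 < α + 1 := by linarith
  have : 0 < β + 1 := by linarith
  have : 0 < α + β + 2 := by linarith
  have : 0 < α + β + 3 := by linarith
  positivity

theorem not_squareOrthogonal_vecQ_self (hα : -1 < α) (hβ : -1 < β) (n : ℕ)
    (i : Fin (n + 1) ⊕ Fin n) : ¬ SquareOrthogonal α β (vecQ α β n i) (vecQ α β n i) := by
  rcases i with k | k
  · exact not_squareOrthogonal_self_parity hα hβ (by norm_num) (by norm_num) k n one_ne_zero
      (evenQ₁_eq α β k n)
  · obtain _ | n := n
    · exact k.elim0
    · exact not_squareOrthogonal_self_parity hα hβ (by norm_num) (by norm_num) k n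
        (evenQ₂_constant_pos hα hβ).ne' (evenQ₂_eq α β k n)

variable {m : ℕ} (Γ : Matrix (Fin (m + 2) ⊕ Fin (m + 1)) (Fin (m + 1) ⊕ Fin m) ℝ)

/-- A drop in degree would enlarge the class of test polynomials in `IsQuasiOrthogonal`. It cannot
occur: the entry of ℚ_{2m+2} would be orthogonal to the sum and to the correction, hence to itself.
-/
theorem le_totalDegree_vecQGamma (hα : -1 < α) (hβ : -1 < β) (i : Fin (m + 2) ⊕ Fin (m + 1)) :
    2 * (m + 1) ≤ (vecQGamma α β m Γ i).totalDegree := by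
  by_contra! h
  have ho := isOrthogonalPoly_vecQ hα hβ (m + 1) i
  refine not_squareOrthogonal_vecQ_self hα hβ (m + 1) i ?_
  have h1 := (ho.2 _ h).symm
  have h2 : SquareOrthogonal α β (∑ j, MvPolynomial.C (-Γ i j) * vecQ α β m j)
      (vecQ α β (m + 1) i) := SquareOrthogonal.sum _ fun j _ => SquareOrthogonal.C_mul _
    (ho.2 _ ((isOrthogonalPoly_vecQ hα hβ m j).1.trans_lt (by omega))).symm
  convert h1.add h2 using 1
  simp only [vecQGamma, MvPolynomial.C_neg, neg_mul, Finset.sum_neg_distrib, add_neg_cancel_right]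

theorem isQuasiOrthogonal_vecQGamma (hα : -1 < α) (hβ : -1 < β)
    (i : Fin (m + 2) ⊕ Fin (m + 1)) :
    IsQuasiOrthogonal α β (4 * m + 1) (vecQGamma α β m Γ i) := by
  intro q hq
  -- This leaves deg q ≤ 2m - 1, low enough for the correction terms of degree 2m as well.
  have h := le_totalDegree_vecQGamma Γ hα hβ i
  exact ((isOrthogonalPoly_vecQ hα hβ (m + 1) i).2 q (by omega)).add
    (SquareOrthogonal.sum _ fun j _ => SquareOrthogonal.C_mul _
      ((isOrthogonalPoly_vecQ hα hβ m j).2 q (by omega)))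

end Orthogonality

/-! ### Choice of Γ and the common zeros -/

section Variety

variable {K : Type*} [Field K] [Algebra ℝ K] {α β : ℝ}

/-- The coefficient of `P_{min(k, n), n}` in the correction of `P_{k, n + 1}`. -/
def correctionCoeff (ρ : ℝ) (n k : ℕ) : ℝ :=
  if k < n then ρ else if k = n then √2 * ρ else -ρ ^ 2

/-- The value at `a` of `p_{n+1} + ρ p_n`. -/
def quasiJacobi (α β ρ : ℝ) (n : ℕ) (a : K) : K :=
  aeval a (jacobiP α β (n + 1)) + algebraMap ℝ K ρ * aeval a (jacobiP α β n)

/-- The value of `P_{k,n+1} + γ_k P_{min(k,n),n}` in the variables `a`, `b`. -/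
def correctedSym (α β ρ : ℝ) (k n : ℕ) (a b : K) : K :=
  MvPolynomial.aeval ![a, b] (koornwinderSym α β k (n + 1)) +
    algebraMap ℝ K (correctionCoeff ρ n k) *
      MvPolynomial.aeval ![a, b] (koornwinderSym α β (min k n) n)

theorem algebraMap_sqrt_two_mul_self : algebraMap ℝ K √2 * algebraMap ℝ K √2 = 2 := by
  rw [← map_mul, Real.mul_self_sqrt (by norm_num)]
  exact map_ofNat _ 2

/-- For k = n the coefficient √2 ρ meets the √2 in P_{n,n}, giving the 2ρ p_n(a) p_n(b) that both
terms on the right produce. -/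
theorem correctedSym_of_le (ρ : ℝ) {k n : ℕ} (hk : k ≤ n) (a b : K) :
    correctedSym α β ρ k n a b =
      quasiJacobi α β ρ n a * aeval b (jacobiP α β k) +
        quasiJacobi α β ρ n b * aeval a (jacobiP α β k) := by
  unfold correctedSym quasiJacobi
  rw [min_eq_left hk, aeval_koornwinderSym, aeval_koornwinderSym, if_neg (by omega),
    correctionCoeff]
  rcases eq_or_lt_of_le hk with rfl | h
  · rw [if_neg (lt_irrefl _), if_pos rfl, if_pos rfl, map_mul]
    linear_combination (algebraMap ℝ K ρ * aeval a (jacobiP α β k) * aeval b (jacobiP α β k)) *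
      algebraMap_sqrt_two_mul_self (K := K)
  · rw [if_pos h, if_neg h.ne]
    ring

/-- The mixed terms ρ p_n(a) p_{n+1}(b) cancel, leaving -ρ² p_n(a) p_n(b); this dictates the
coefficient -ρ². -/
theorem correctedSym_succ (ρ : ℝ) (n : ℕ) (a b : K) :
    correctedSym α β ρ (n + 1) n a b = algebraMap ℝ K √2 *
      (quasiJacobi α β ρ n a * aeval b (jacobiP α β (n + 1)) -
        algebraMap ℝ K ρ * aeval a (jacobiP α β n) * quasiJacobi α β ρ n b) := by
  unfold correctedSym quasiJacobi
  rw [min_eq_right (Nat.le_succ n), aeval_koornwinderSym, aeval_koornwinderSym, if_pos rfl,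
    if_pos rfl, correctionCoeff, if_neg (by omega), if_neg (by omega), map_neg, map_pow]
  ring

theorem correctedSym_eq_zero {ρ : ℝ} {k n : ℕ} (hk : k ≤ n + 1) {a b : K}
    (ha : quasiJacobi α β ρ n a = 0) (hb : quasiJacobi α β ρ n b = 0) :
    correctedSym α β ρ k n a b = 0 := by
  rcases Nat.le_succ_iff.1 hk with h | rfl
  · rw [correctedSym_of_le ρ h, ha, hb]; ring
  · rw [correctedSym_succ, ha, hb]; ring

theorem aeval_jacobiP_zero (hα : -1 < α) (hβ : -1 < β) :
    ∃ c : K, c ≠ 0 ∧ ∀ a : K, aeval a (jacobiP α β 0) = c := by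
  have hd : (jacobiP α β 0).degree = 0 := by simpa using degree_jacobiP hα hβ 0
  rw [eq_C_of_degree_eq_zero hd]
  refine ⟨algebraMap ℝ K ((jacobiP α β 0).coeff 0), ?_, fun a => aeval_C _ _⟩
  rw [Ne, map_eq_zero]
  exact coeff_ne_zero_of_eq_degree hd

/-- The indices 0, n, n + 1 suffice. Index 0 gives R(b) = -R(a). If R(a) ≠ 0, the other two give
p_n(b) = p_n(a) and p_{n+1}(b) = -ρ p_n(a), so R(b) = 0, a contradiction. -/
theorem quasiJacobi_eq_zero_of_correctedSym_eq_zero (hα : -1 < α) (hβ : -1 < β) {ρ : ℝ} {n : ℕ}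
    {a b : K} (h : ∀ k ≤ n + 1, correctedSym α β ρ k n a b = 0) :
    quasiJacobi α β ρ n a = 0 ∧ quasiJacobi α β ρ n b = 0 := by
  obtain ⟨c, hc, h0⟩ := aeval_jacobiP_zero (K := K) hα hβ
  have e0 := h 0 (Nat.zero_le _)
  have e1 := h n (Nat.le_succ n)
  have e2 := h (n + 1) le_rfl
  rw [correctedSym_of_le ρ (Nat.zero_le n), h0, h0, ← add_mul, mul_eq_zero, or_iff_left hc] at e0
  rw [correctedSym_of_le ρ le_rfl] at e1
  rw [correctedSym_succ, mul_eq_zero, or_iff_right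
    (fun h2 => by simp at h2)] at e2
  have hb : quasiJacobi α β ρ n b = -quasiJacobi α β ρ n a := by linear_combination e0
  suffices quasiJacobi α β ρ n a = 0 from ⟨this, by rw [hb, this, neg_zero]⟩
  by_contra hR
  have f1 : aeval b (jacobiP α β n) = aeval a (jacobiP α β n) := by
    refine mul_left_cancel₀ hR ?_
    rw [hb] at e1
    linear_combination e1
  have f2 : aeval b (jacobiP α β (n + 1)) = -(algebraMap ℝ K ρ * aeval a (jacobiP α β n)) := by
    refine mul_left_cancel₀ hR ?_
    rw [hb] at e2
    linear_combination e2
  have : quasiJacobi α β ρ n b = 0 := by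
    unfold quasiJacobi
    rw [f1, f2]; ring
  exact hR (by rw [← neg_neg (quasiJacobi α β ρ n a), ← hb, this, neg_zero])

/-- The matrix with the coefficients of the corrections in the two blocks. -/
def correctionMatrix (ρ σ : ℝ) (m : ℕ) :
    Matrix (Fin (m + 2) ⊕ Fin (m + 1)) (Fin (m + 1) ⊕ Fin m) ℝ :=
  Matrix.fromBlocks
    (Matrix.of fun k j => if (j : ℕ) = min (k : ℕ) m then correctionCoeff ρ m k else 0) 0 0
    (Matrix.of fun k j => if (j : ℕ) = min (k : ℕ) (m - 1) then correctionCoeff σ (m - 1) k else 0)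

theorem sum_ite_val_eq {M : Type*} [AddCommMonoid M] {n k : ℕ} (hk : k < n) (f : Fin n → M) :
    ∑ j : Fin n, (if (j : ℕ) = k then f j else 0) = f ⟨k, hk⟩ := by
  rw [Finset.sum_eq_single (⟨k, hk⟩ : Fin n)]
  · simp
  · intro j _ hj
    exact if_neg fun h => hj (Fin.ext h)
  · simp

theorem aeval_vecQGamma_inl (ρ σ : ℝ) (m : ℕ) (k : Fin (m + 2)) {x y a b : K}
    (h1 : 2 * x * y = a + b) (h2 : x ^ 2 + y ^ 2 - 1 = a * b) :
    MvPolynomial.aeval ![x, y] (vecQGamma α β m (correctionMatrix ρ σ m) (Sum.inl k)) =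
      correctedSym α β ρ k m a b := by
  simp only [vecQGamma, correctionMatrix, Fintype.sum_sum_type, Matrix.fromBlocks_apply₁₁,
    Matrix.fromBlocks_apply₁₂, Matrix.zero_apply, Matrix.of_apply, MvPolynomial.C_0, zero_mul,
    Finset.sum_const_zero, add_zero, apply_ite MvPolynomial.C, ite_mul]
  rw [sum_ite_val_eq (show min (k : ℕ) m < m + 1 by omega)]
  simp only [vecQ, Sum.elim_inl, evenQ₁, map_add, map_mul, MvPolynomial.aeval_C,
    aeval_parabolicSubst_koornwinder α β _ _ h1 h2]
  rfl

theorem aeval_vecQGamma_inr (ρ σ : ℝ) (n : ℕ) (k : Fin (n + 2)) {x y a b : K}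
    (h1 : 2 * x * y = a + b) (h2 : x ^ 2 + y ^ 2 - 1 = a * b) :
    MvPolynomial.aeval ![x, y] (vecQGamma α β (n + 1) (correctionMatrix ρ σ (n + 1))
      (Sum.inr k)) =
      algebraMap ℝ K ((α + β + 2) * (α + β + 3) / (4 * (α + 1) * (β + 1))) * (x ^ 2 - y ^ 2) *
        correctedSym (α + 1) (β + 1) σ k n a b := by
  simp only [vecQGamma, correctionMatrix, Fintype.sum_sum_type, Matrix.fromBlocks_apply₂₁,
    Matrix.fromBlocks_apply₂₂, Matrix.zero_apply, Matrix.of_apply, MvPolynomial.C_0, zero_mul,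
    Finset.sum_const_zero, zero_add, apply_ite MvPolynomial.C, ite_mul, Nat.add_sub_cancel]
  rw [sum_ite_val_eq (show min (k : ℕ) n < n + 1 by omega)]
  simp only [vecQ, Sum.elim_inr, evenQ₂, map_add, map_mul, MvPolynomial.aeval_C, map_sub, map_pow,
    MvPolynomial.aeval_X, Matrix.cons_val_zero, Matrix.cons_val_one, Nat.add_sub_cancel,
    aeval_parabolicSubst_koornwinder (α + 1) (β + 1) _ _ h1 h2, correctedSym]
  ring

theorem mem_zeroLocus_nodeIdeal {m : ℕ}
    {Γ : Matrix (Fin (m + 2) ⊕ Fin (m + 1)) (Fin (m + 1) ⊕ Fin m) ℝ} {x : Fin 2 → K} :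
    x ∈ MvPolynomial.zeroLocus K (nodeIdeal α β m Γ) ↔
      (∀ k : Fin (m + 1), MvPolynomial.aeval x (oddQ₂ α β k m) = 0) ∧
        ∀ i, MvPolynomial.aeval x (vecQGamma α β m Γ i) = 0 := by
  rw [nodeIdeal, MvPolynomial.zeroLocus_span]
  simp only [Set.mem_ofPred_eq, Set.mem_union, or_imp, forall_and, Set.forall_mem_range]

/-- The matrix `Γ` can be chosen such that the common zeros of the generators of the ideal are
the points for which both `a` and `b` are zeros of `(1 - t) p_m^{(α+1,β)}(t)`. -/
theorem exists_correctionMatrix (hα : -1 < α) (hβ : -1 < β) (m : ℕ) :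
    ∃ Γ : Matrix (Fin (m + 2) ⊕ Fin (m + 1)) (Fin (m + 1) ⊕ Fin m) ℝ,
      ∀ x y a b : K, 2 * x * y = a + b → x ^ 2 + y ^ 2 - 1 = a * b →
        (![x, y] ∈ MvPolynomial.zeroLocus K (nodeIdeal α β m Γ) ↔
          (a = 1 ∨ aeval a (jacobiP (α + 1) β m) = 0) ∧
            (b = 1 ∨ aeval b (jacobiP (α + 1) β m) = 0)) := by
  have hα' : -1 < α + 1 := by linarith
  obtain ⟨c, hc, ρ, hρ⟩ := exists_one_sub_X_mul_jacobiP hα hβ m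
  obtain ⟨σ, hσ⟩ : ∃ σ : ℝ, ∀ n, m = n + 1 → ∀ z : K, aeval z (jacobiP (α + 1) β m) = 0 →
      quasiJacobi (α + 1) (β + 1) σ n z = 0 := by
    obtain _ | n := m
    · exact ⟨0, fun n hn => by omega⟩
    · obtain ⟨d, hd, σ, hσ⟩ := exists_jacobiP_succ_eq hα' hβ n
      refine ⟨σ, fun n' hn z hz => ?_⟩
      obtain rfl : n = n' := by omega
      rw [hσ] at hz
      simp only [map_mul, map_add, aeval_C, mul_eq_zero, map_eq_zero, hd, false_or] at hz
      exact hz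
  have hr : ∀ z : K, quasiJacobi α β ρ m z = 0 ↔
      z = 1 ∨ aeval z (jacobiP (α + 1) β m) = 0 := by
    intro z
    have h := congrArg (aeval z) hρ
    simp only [map_mul, map_add, map_sub, map_one, aeval_X, aeval_C] at h
    have hc' : algebraMap ℝ K c ≠ 0 := by rwa [Ne, map_eq_zero]
    rw [← sub_eq_zero (b := (1 : K)), ← neg_sub, neg_eq_zero, ← mul_eq_zero, h, mul_eq_zero,
      or_iff_right hc']
    rfl
  refine ⟨correctionMatrix ρ σ m, fun x y a b h1 h2 => ?_⟩
  rw [mem_zeroLocus_nodeIdeal, ← hr, ← hr]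
  constructor
  · rintro ⟨-, h⟩
    refine quasiJacobi_eq_zero_of_correctedSym_eq_zero hα hβ fun k hk => ?_
    rw [← aeval_vecQGamma_inl ρ σ m ⟨k, by omega⟩ h1 h2]
    exact h _
  · rintro ⟨ha, hb⟩
    -- The factor x - y takes over exactly when one of a, b is the extra zero 1 of R.
    have hxy : x = y ∨ (aeval a (jacobiP (α + 1) β m) = 0 ∧
        aeval b (jacobiP (α + 1) β m) = 0) := by
      have e : (x - y) ^ 2 = (1 - a) * (1 - b) := by linear_combination h2 - h1
      rcases (hr a).1 ha with rfl | ha'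
      · left
        rwa [sub_self, zero_mul, sq_eq_zero_iff, sub_eq_zero] at e
      rcases (hr b).1 hb with rfl | hb'
      · left
        rwa [sub_self, mul_zero, sq_eq_zero_iff, sub_eq_zero] at e
      exact Or.inr ⟨ha', hb'⟩
    refine ⟨fun k => ?_, ?_⟩
    · simp only [oddQ₂, map_mul, map_sub, MvPolynomial.aeval_X, Matrix.cons_val_zero,
        Matrix.cons_val_one, aeval_parabolicSubst_koornwinder (α + 1) β _ _ h1 h2]
      rcases hxy with rfl | ⟨ha', hb'⟩
      · simp
      · rw [aeval_koornwinderSym, ha', hb']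
        simp
    · rintro (k | k)
      · rw [aeval_vecQGamma_inl ρ σ m k h1 h2]
        exact correctedSym_eq_zero (by omega) ha hb
      -- For m = 0 the second block has no correction, and p_0 has no zeros, so x = y is the only
      -- case.
      · obtain _ | n := m
        · rcases hxy with rfl | ⟨ha', -⟩
          · simp [vecQGamma, vecQ, evenQ₂, correctionMatrix]
          · obtain ⟨c, hc, h0⟩ := aeval_jacobiP_zero (K := K) hα' hβ
            exact absurd ((h0 a).symm.trans ha') hc
        · rw [aeval_vecQGamma_inr ρ σ n k h1 h2]
          rcases hxy with rfl | ⟨ha', hb'⟩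
          · simp
          · rw [correctedSym_eq_zero (by omega) (hσ n rfl a ha') (hσ n rfl b hb'), mul_zero]

theorem eq_one_or_aeval_jacobiP_eq_zero_iff (hα : -1 < α) (hβ : -1 < β) {m : ℕ} {z : ℂ} :
    (z = 1 ∨ aeval z (jacobiP (α + 1) β m) = 0) ↔
      ∃ θ ∈ nodeAngles α β m, z = (Real.cos θ : ℂ) := by
  constructor
  · rintro (rfl | h)
    · exact ⟨0, Or.inl rfl, by simp⟩
    · obtain ⟨x, hx, h0, rfl⟩ :=
        exists_ofReal_eq_of_aeval_jacobiP_eq_zero (by linarith) hβ h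
      have hcos : Real.cos (Real.arccos x) = x := Real.cos_arccos hx.1.le hx.2.le
      refine ⟨Real.arccos x, Or.inr ⟨⟨Real.arccos_pos.2 hx.2, ?_⟩, by rwa [hcos]⟩, by rw [hcos]⟩
      refine lt_of_le_of_ne (Real.arccos_le_pi x) fun h => ?_
      exact not_le.2 hx.1 (Real.arccos_eq_pi.1 h)
  · rintro ⟨θ, h | ⟨-, h⟩, rfl⟩
    · left
      rw [Set.mem_singleton_iff.1 h]; simp
    · right
      rw [← Complex.coe_algebraMap, aeval_algebraMap_apply, coe_aeval_eq_eval, h, map_zero]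

theorem two_mul_cos_half_mul_cos_half (θ φ : ℝ) :
    2 * Real.cos ((θ - φ) / 2) * Real.cos ((θ + φ) / 2) = Real.cos θ + Real.cos φ := by
  rw [Real.cos_add_cos]; ring

theorem cos_half_sq_add_cos_half_sq (θ φ : ℝ) :
    Real.cos ((θ - φ) / 2) ^ 2 + Real.cos ((θ + φ) / 2) ^ 2 - 1 = Real.cos θ * Real.cos φ := by
  rw [Real.cos_sq, Real.cos_sq, show 2 * ((θ - φ) / 2) = θ - φ by ring,
    show 2 * ((θ + φ) / 2) = θ + φ by ring, Real.cos_add, Real.cos_sub]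
  ring

/-- The hypotheses fix (x + y)² and (x - y)²; the two choices of sign give the four points. -/
theorem eq_of_elementary_eq {x y s t : ℂ} (h1 : 2 * x * y = 2 * s * t)
    (h2 : x ^ 2 + y ^ 2 - 1 = s ^ 2 + t ^ 2 - 1) :
    (x = s ∧ y = t) ∨ (x = t ∧ y = s) ∨ (x = -s ∧ y = -t) ∨ (x = -t ∧ y = -s) := by
  have e1 : (x + y) ^ 2 = (s + t) ^ 2 := by linear_combination h1 + h2
  have e2 : (x - y) ^ 2 = (s - t) ^ 2 := by linear_combination h2 - h1
  rcases sq_eq_sq_iff_eq_or_eq_neg.1 e1 with e1 | e1 <;>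
    rcases sq_eq_sq_iff_eq_or_eq_neg.1 e2 with e2 | e2
  · left; exact ⟨by linear_combination (e1 + e2) / 2, by linear_combination (e1 - e2) / 2⟩
  · right; left; exact ⟨by linear_combination (e1 + e2) / 2, by linear_combination (e1 - e2) / 2⟩
  · right; right; right; exact ⟨by linear_combination (e1 + e2) / 2, by linear_combination (e1 - e2) / 2⟩
  · right; right; left; exact ⟨by linear_combination (e1 + e2) / 2, by linear_combination (e1 - e2) / 2⟩

theorem mem_image_nearMinNodes_iff {m : ℕ} {x y : ℂ} :
    ![x, y] ∈ (fun x i => (x i : ℂ)) '' nearMinNodes α β m ↔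
      ∃ θ ∈ nodeAngles α β m, ∃ φ ∈ nodeAngles α β m,
        2 * x * y = Real.cos θ + Real.cos φ ∧ x ^ 2 + y ^ 2 - 1 = Real.cos θ * Real.cos φ := by
  have hvec : ∀ u v : ℝ, (fun i => ((![u, v] : Fin 2 → ℝ) i : ℂ)) = ![(u : ℂ), (v : ℂ)] := by
    intro u v
    funext i
    fin_cases i <;> rfl
  have hinj : ∀ u v : ℂ, ![u, v] = ![x, y] ↔ x = u ∧ y = v := by
    intro u v
    simp [eq_comm]
  have g1 := fun θ φ : ℝ => congrArg (fun r : ℝ => (r : ℂ)) (two_mul_cos_half_mul_cos_half θ φ)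
  have g2 := fun θ φ : ℝ => congrArg (fun r : ℝ => (r : ℂ)) (cos_half_sq_add_cos_half_sq θ φ)
  simp only [Complex.ofReal_mul, Complex.ofReal_add, Complex.ofReal_sub, Complex.ofReal_pow,
    Complex.ofReal_one, Complex.ofReal_ofNat] at g1 g2
  constructor
  · rintro ⟨_, ⟨θ, hθ, φ, hφ, -, s, t, hs, ht, hz⟩, hxy⟩
    refine ⟨θ, hθ, φ, hφ, ?_⟩
    rw [← g1, ← g2, ← hs, ← ht]
    rcases hz with rfl | rfl | rfl | rfl <;>
    · simp only [hvec] at hxy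
      obtain ⟨rfl, rfl⟩ := (hinj _ _).1 hxy
      push_cast
      constructor <;> ring
  · rintro ⟨θ, hθ, φ, hφ, h1, h2⟩
    -- Both equations are symmetric in θ and φ, which the node set orders.
    wlog hle : θ ≤ φ generalizing θ φ
    · exact this φ hφ θ hθ (h1.trans (add_comm _ _)) (h2.trans (mul_comm _ _)) (le_of_not_ge hle)
    rw [← g1] at h1
    rw [← g2] at h2
    have hmem := fun z hz => show z ∈ nearMinNodes α β m from
      ⟨θ, hθ, φ, hφ, hle, _, _, rfl, rfl, hz⟩
    rcases eq_of_elementary_eq h1 h2 with ⟨rfl, rfl⟩ | ⟨rfl, rfl⟩ | ⟨rfl, rfl⟩ | ⟨rfl, rfl⟩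
    · exact ⟨_, hmem _ (Or.inl rfl), hvec _ _⟩
    · exact ⟨_, hmem _ (Or.inr (Or.inl rfl)), hvec _ _⟩
    · exact ⟨_, hmem _ (Or.inr (Or.inr (Or.inl rfl))), by simp only [hvec, Complex.ofReal_neg]⟩
    · exact ⟨_, hmem _ (Or.inr (Or.inr (Or.inr rfl))), by simp only [hvec, Complex.ofReal_neg]⟩

/-- Even for real (x, y) the roots a, b may a priori be complex, so the complex variety is computed
first and the real one is read off from it. -/
theorem exists_add_eq_mul_eq (u v : ℂ) : ∃ a b : ℂ, u = a + b ∧ v = a * b := by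
  obtain ⟨d, hd⟩ := IsAlgClosed.exists_pow_nat_eq (u ^ 2 - 4 * v) (n := 2) (by norm_num)
  exact ⟨(u + d) / 2, (u - d) / 2, by ring, by linear_combination hd / 4⟩

theorem exists_zeroLocus_complex_eq (hα : -1 < α) (hβ : -1 < β) (m : ℕ) :
    ∃ Γ : Matrix (Fin (m + 2) ⊕ Fin (m + 1)) (Fin (m + 1) ⊕ Fin m) ℝ,
      MvPolynomial.zeroLocus ℂ (nodeIdeal α β m Γ) =
        (fun x i => (x i : ℂ)) '' nearMinNodes α β m := by
  obtain ⟨Γ, hΓ⟩ := exists_correctionMatrix (K := ℂ) hα hβ m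
  refine ⟨Γ, Set.ext fun z => ?_⟩
  obtain ⟨x, y, rfl⟩ : ∃ x y, z = ![x, y] := ⟨z 0, z 1, by ext i; fin_cases i <;> rfl⟩
  rw [mem_image_nearMinNodes_iff]
  constructor
  · intro h
    obtain ⟨a, b, h1, h2⟩ := exists_add_eq_mul_eq (2 * x * y) (x ^ 2 + y ^ 2 - 1)
    obtain ⟨ha, hb⟩ := (hΓ x y a b h1 h2).1 h
    obtain ⟨θ, hθ, rfl⟩ := (eq_one_or_aeval_jacobiP_eq_zero_iff hα hβ).1 ha
    obtain ⟨φ, hφ, rfl⟩ := (eq_one_or_aeval_jacobiP_eq_zero_iff hα hβ).1 hb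
    exact ⟨θ, hθ, φ, hφ, h1, h2⟩
  · rintro ⟨θ, hθ, φ, hφ, h1, h2⟩
    exact (hΓ x y _ _ h1 h2).2 ⟨(eq_one_or_aeval_jacobiP_eq_zero_iff hα hβ).2 ⟨θ, hθ, rfl⟩,
      (eq_one_or_aeval_jacobiP_eq_zero_iff hα hβ).2 ⟨φ, hφ, rfl⟩⟩

theorem mem_zeroLocus_real_iff (I : Ideal (MvPolynomial (Fin 2) ℝ)) (x : Fin 2 → ℝ) :
    x ∈ MvPolynomial.zeroLocus ℝ I ↔
      (fun i => (x i : ℂ)) ∈ MvPolynomial.zeroLocus ℂ I := by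
  simp only [MvPolynomial.mem_zeroLocus_iff]
  refine forall₂_congr fun p _ => ?_
  have : MvPolynomial.aeval (fun i => (x i : ℂ)) p =
      algebraMap ℝ ℂ (MvPolynomial.aeval x p) :=
    MvPolynomial.aeval_algebraMap_apply ℂ x p
  rw [this, map_eq_zero_iff _ (algebraMap ℝ ℂ).injective]

end Variety
end

theorem mainTheorem3 (α β : ℝ) (hα : -1 < α) (hβ : -1 < β) (m : ℕ) :
    (∀ k : Fin (m + 1), IsOrthogonalPoly α β (2 * m + 1) (oddQ₂ α β k m)) ∧
    ∃ Γ : Matrix (Fin (m + 2) ⊕ Fin (m + 1)) (Fin (m + 1) ⊕ Fin m) ℝ,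
      (∀ i, IsQuasiOrthogonal α β (4 * m + 1) (vecQGamma α β m Γ i)) ∧
      MvPolynomial.zeroLocus ℝ (nodeIdeal α β m Γ) = nearMinNodes α β m ∧
      MvPolynomial.zeroLocus ℂ (nodeIdeal α β m Γ) =
        (fun x i => (x i : ℂ)) '' nearMinNodes α β m := by
  refine ⟨fun k => isOrthogonalPoly_oddQ₂ hα hβ (by omega), ?_⟩
  obtain ⟨Γ, hΓ⟩ := exists_zeroLocus_complex_eq hα hβ m
  refine ⟨Γ, isQuasiOrthogonal_vecQGamma Γ hα hβ, Set.ext fun x => ?_, hΓ⟩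
  have hinj : Function.Injective fun (x : Fin 2 → ℝ) i => (x i : ℂ) := fun x y h =>
    funext fun i => Complex.ofReal_injective (congrFun h i)
  rw [mem_zeroLocus_real_iff, hΓ]
  exact hinj.mem_set_image
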